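/- **Setting.** Let $d\in\{2,3\}$, $k\ge 1$, and let $\Omega\subset\mathbb R^d$ be a bounded open set (for instance a polyhedral Lipschitz domain) with boundary $\Gamma$ and a conforming simplicial triangulation $\mathcal T_\Omega$, i.e., $\overline\Omega$ is the union of its $d$-simplices and $\Gamma$ is the union of those $(d-1)$-dimensional faces that lie on $\Gamma$. Let $h$ be the maximal diameter of the $d$-simplices, and suppose that $\mathcal T_\Omega$ is quasi-uniform with parameter $\sigma>0$: every $d$-simplex contains a ball of radius $\sigma h$. Let $\alpha\in L^\infty(\Omega)$ and $\kappa\in L^\infty(\Gamma)$ be uniformly positive, with $\alpha\le\alpha_{\max}$ a.e. Let $\mathbb V_h$ be the space of continuous piecewise polynomials of degree at most $k$ on $\mathcal T_\Omega$, with Lagrange nodal basis $(\varphi_i)_{i\le N_u}$, the nodes being ordered such that the $N_\lambda$ nodes on $\Gamma$ come last; let $\mathbb M_h=\mathbb V_h|_\Gamma$ with basis $\psi_i=\varphi_{N_u-N_\lambda+i}|_\Gamma$, $i\le N_\lambda$; and let $\mathbb Q_h$ be a space of continuous piecewise polynomials on a triangulation of $\Gamma$, with basis $(q_j)_{j\le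 N_p}$. Define $$(M_u)_{ij}=\int_\Omega\varphi_i\varphi_j,\quad (K_u)_{ij}=\int_\Omega\alpha\nabla\varphi_i\cdot\nabla\varphi_j,\quad (M_p)_{ij}=\int_\Gamma q_iq_j,\quad (K_p)_{ij}=\int_\Gamma\kappa\nabla_\Gamma q_i\cdot\nabla_\Gamma q_j,$$ $$(M_\lambda)_{ij}=\int_\Gamma\psi_i\psi_j,\quad (B_u)_{ij}=\int_\Gamma\psi_i\varphi_j,\quad (B_p)_{ij}=\int_\Gamma\psi_iq_j .$$ Coefficient vectors $u\in\mathbb R^{N_u}$ are split into $u=(u_1,u_2)$ with $u_2\in\mathbb R^{N_\lambda}$; $M_{ij}$ and $K_{ij}$, $i,j\in\{1,2\}$, denote the corresponding blocks of $M_u$ and $K_u$. Write $\|x\|_A^2=x^TAx$. For $\tau>0$ put $$Ex^n=x^n-x^{n-1},\quad D_\tau x^n=\tfrac1{2\tau}(3x^n-4x^{n-1}+x^{n-2}),\quad \widetilde D_\tau x^n=\tfrac1{2\tau}(5x^{n-1}-8x^{n-2}+3x^{n-3}).$$ Let $u^{-1},u^0\in\mathbb R^{N_u}$ and $p^{-2},p^{-1},p^0\in\mathbb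 R^{N_p}$ be consistent initial data, i.e., $B_uu^j=B_pp^j$ for $j=-1,0$, set $\hat u^{-1}=u^{-1}$, $\hat u^0=u^0$, let $f_u^n=(f_1^n,f_2^n)\in\mathbb R^{N_u}$ and $f_p^n\in\mathbb R^{N_p}$, $n\ge1$, be arbitrary right-hand sides, and let $(\hat u^n,p^n,\lambda^n)$, $n\ge1$, satisfy the auxiliary scheme $$\begin{aligned} M_{11}D_\tau\hat u_1^n+K_{11}\hat u_1^n&=f_1^n-M_{12}M_\lambda^{-1}B_p\widetilde D_\tau p^n-K_{12}M_\lambda^{-1}B_p(2p^{n-1}-p^{n-2}),\\ M_{21}D_\tau\hat u_1^n+K_{21}\hat u_1^n-M_\lambda\lambda^n&=f_2^n-M_{22}M_\lambda^{-1}B_p\widetilde D_\tau p^n-K_{22}M_\lambda^{-1}B_p(2p^{n-1}-p^{n-2}),\\ M_pD_\tau p^n+K_pp^n+B_p^T\lambda^n&=f_p^n,\qquad M_\lambda\hat u_2^n=B_pp^n . \end{aligned}$$ **Proposition (stability of the auxiliary scheme).** There are constants $c_M>0$, depending only on $d,k,\sigma$, and $c_K,h_0,C>0$, depending only on $d,k,\sigma,\alpha_{\max}$,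 such that in the above setting the following holds. (i) If $B_uu=B_pp$ for some $u\in\mathbb R^{N_u}$, $p\in\mathbb R^{N_p}$, then $\|u_2\|_{M_{22}}^2\le c_Mh\,\|p\|_{M_p}^2$ and $\|u_2\|_{K_{22}}^2\le c_Kh^{-1}\|p\|_{M_p}^2$. (ii) For all $n\ge-2$, $$\begin{aligned} &\|\hat u^{n+3}\|_{K_u}^2+\|p^{n+3}\|_{K_p}^2+\tau\sum_{j=1}^{n+3}\Big(\|\tfrac1\tau E\hat u^j\|_{M_u}^2+\|\tfrac1\tau Ep^j\|_{M_p}^2+\tfrac12\|\tfrac1\tau E^2\hat u^j\|_{M_u}^2\Big)\\ &\qquad+\tau\sum_{j=1}^{n+3}\big(\tfrac12-18c_Mh-c_K\tau h^{-1}\big)\|\tfrac1\tau E^2p^j\|_{M_p}^2+\sum_{j=1}^{n+3}\|Ep^j\|_{K_p}^2\\ &\le\|u^0\|_{K_u}^2+\|p^0\|_{K_p}^2+\tfrac\tau2\|\tfrac1\tau Eu^0\|_{M_u}^2+\tfrac\tau2\|\tfrac1\tau Ep^0\|_{M_p}^2+9c_M\tau h\,\|\tfrac1\tau E^2p^0\|_{M_p}^2\\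 &\qquad+2\tau\sum_{j=1}^{n+3}\Big(\|f_u^j\|_{M_u^{-1}}^2+\|f_p^j\|_{M_p^{-1}}^2\Big). \end{aligned}$$ (iii) If $h\le h_0$ and $\tau\le Ch$, then $\tfrac12-18c_Mh-c_K\tau h^{-1}\ge0$, and hence the estimate in (ii) remains true, for all $n\ge-2$, when the terms with $\|\tfrac1\tau E^2p^j\|_{M_p}^2$, $j\ge1$, are omitted. -/

import Mathlib

open MeasureTheory Matrix

/-- `ℝ^d` with the Euclidean norm. -/
abbrev Euc (d : ℕ) : Type := EuclideanSpace ℝ (Fin d)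

/-- The simplex with vertex set `s`, as a subset of `ℝ^d`. -/
def simplexHull {d : ℕ} (s : Finset (Euc d)) : Set (Euc d) := convexHull ℝ (s : Set (Euc d))

/-- `v` coincides on `S` with a polynomial of total degree at most `k`. -/
def IsPolyOn {d : ℕ} (k : ℕ) (v : Euc d → ℝ) (S : Set (Euc d)) : Prop :=
  ∃ P : MvPolynomial (Fin d) ℝ, P.totalDegree ≤ k ∧
    ∀ x ∈ S, v x = MvPolynomial.eval (fun i => x i) P

/-- Membership in the conforming Lagrange space `𝒫_k` of a simplicial complex: continuous on the
underlying set and polynomial of degree at most `k` on every simplex. -/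
def InLagrangeSpace {d : ℕ} (K : Geometry.SimplicialComplex ℝ (Euc d)) (k : ℕ)
    (v : Euc d → ℝ) : Prop :=
  ContinuousOn v K.space ∧ ∀ s ∈ K.faces, IsPolyOn k v (simplexHull s)

/-- The Lagrange nodes of order `k`: the points with barycentric coordinates in `(1/k) ℕ` with
respect to some simplex of the complex. -/
def lagrangeNodes {d : ℕ} (K : Geometry.SimplicialComplex ℝ (Euc d)) (k : ℕ) : Set (Euc d) :=
  {x | ∃ s ∈ K.faces, ∃ m : Euc d → ℕ, ∑ a ∈ s, m a = k ∧
    x = ∑ a ∈ s, ((m a : ℝ) / (k : ℝ)) • a}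

/-- The tangential gradient of `p` at a point `x` of the flat simplex `s`: the gradient of `p`,
viewed near `x` as a function on the part of the tangent space of `s` that parametrizes `s`. -/
noncomputable def tangentialGradient {d : ℕ} (s : Finset (Euc d)) (p : Euc d → ℝ) (x : Euc d) :
    vectorSpan ℝ (s : Set (Euc d)) :=
  gradientWithin (fun v : vectorSpan ℝ (s : Set (Euc d)) => p (x + (v : Euc d)))
    {v | x + (v : Euc d) ∈ simplexHull s} 0

/-- Conforming bulk--surface finite element discretization in `ℝ^d` with Lagrange elements of
degree `k` in the bulk.

The bulk domain is `Ω`, with boundary `Γ = frontier Ω`.  The space `V_h` is the Lagrange space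
`𝒫_k` of a triangulation of `Ω`, with its nodal basis ordered such that interior nodes come first.
The space `M_h` of the multipliers is the space of traces of `V_h`, with the traces of the basis
functions of the boundary nodes as its basis.  The space `Q_h` is any space of continuous
piecewise polynomials on a second triangulation of `Γ`. -/
structure BulkSurfaceFE (d k : ℕ) where
  /-- the bulk domain -/
  Ω : Set (Euc d)
  isOpen_Ω : IsOpen Ω
  /-- the triangulation of the bulk -/
  bulkMesh : Geometry.SimplicialComplex ℝ (Euc d)
  finite_bulkMesh : bulkMesh.faces.Finite
  pure_bulkMesh : ∀ s ∈ bulkMesh.faces, ∃ t ∈ bulkMesh.faces, s ⊆ t ∧ t.card = d + 1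
  space_bulkMesh : bulkMesh.space = closure Ω
  /-- the `(d-1)`-dimensional mesh simplices contained in the boundary triangulate the boundary -/
  boundary_bulkMesh : frontier Ω =
    ⋃ s ∈ {s | s ∈ bulkMesh.faces ∧ s.card = d ∧ simplexHull s ⊆ frontier Ω}, simplexHull s
  /-- the number of interior nodes, which is `N_u - N_λ` -/
  NI : ℕ
  /-- the number of boundary nodes, which is `N_λ` -/
  NB : ℕ
  /-- the enumeration of the Lagrange nodes -/
  node : Fin NI ⊕ Fin NB → Euc d
  node_injective : Function.Injective node
  range_node_inl : Set.range (fun i => node (Sum.inl i)) = lagrangeNodes bulkMesh k \ frontier Ω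
  range_node_inr : Set.range (fun i => node (Sum.inr i)) = lagrangeNodes bulkMesh k ∩ frontier Ω
  /-- the nodal basis of `V_h` -/
  φ : Fin NI ⊕ Fin NB → Euc d → ℝ
  φ_mem : ∀ i, InLagrangeSpace bulkMesh k (φ i)
  φ_node : ∀ i j, φ i (node j) = if i = j then 1 else 0
  /-- the triangulation of the boundary that belongs to `Q_h` -/
  surfMesh : Geometry.SimplicialComplex ℝ (Euc d)
  finite_surfMesh : surfMesh.faces.Finite
  pure_surfMesh : ∀ s ∈ surfMesh.faces, ∃ t ∈ surfMesh.faces, s ⊆ t ∧ t.card = d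
  space_surfMesh : surfMesh.space = frontier Ω
  /-- a bound on the polynomial degree in `Q_h` -/
  ℓ : ℕ
  /-- the dimension of `Q_h` -/
  Np : ℕ
  /-- the basis of `Q_h` -/
  q : Fin Np → Euc d → ℝ
  q_mem : ∀ j, InLagrangeSpace surfMesh ℓ (q j)
  q_indep : LinearIndependent ℝ (fun j => (frontier Ω).domRestrict (q j))
  /-- the diffusion coefficient in the bulk -/
  α : Euc d → ℝ
  aesm_α : AEStronglyMeasurable α (volume.restrict Ω)
  bounds_α : ∃ a₀ > 0, ∃ a₁, ∀ᵐ x ∂(volume.restrict Ω), a₀ ≤ α x ∧ α x ≤ a₁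
  /-- the diffusion coefficient on the boundary -/
  κ : Euc d → ℝ
  aesm_κ : AEStronglyMeasurable κ (μHE[d - 1].restrict (frontier Ω))
  bounds_κ : ∃ b₀ > 0, ∃ b₁, ∀ᵐ x ∂(μHE[d - 1].restrict (frontier Ω)), b₀ ≤ κ x ∧ κ x ≤ b₁

namespace BulkSurfaceFE

variable {d k : ℕ} (D : BulkSurfaceFE d k)

/-- The boundary of the domain. -/
def Γ : Set (Euc d) := frontier D.Ω

/-- The surface measure, i.e., the Euclidean `(d-1)`-dimensional Hausdorff measure on `Γ`. -/
noncomputable def surf : Measure (Euc d) := μHE[d - 1].restrict D.Γ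

/-- The `d`-dimensional simplices of the triangulation of the bulk. -/
def cells : Set (Finset (Euc d)) := {s | s ∈ D.bulkMesh.faces ∧ s.card = d + 1}

/-- The maximal mesh width of the triangulation of the bulk. -/
noncomputable def h : ℝ := sSup ((fun s => Metric.diam (simplexHull s)) '' D.cells)

/-- Quasi-uniformity with uniformity parameter `σ`: every cell contains a ball of radius `σ h`. -/
def QuasiUniform (σ : ℝ) : Prop :=
  ∀ s ∈ D.cells, ∃ c, Metric.closedBall c (σ * D.h) ⊆ simplexHull s

/-- The facets of the triangulation of the boundary that belongs to `Q_h`. -/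
noncomputable def surfFacets : Finset (Finset (Euc d)) :=
  D.finite_surfMesh.toFinset.filter (fun s => s.card = d)

/-- The bulk mass matrix. -/
noncomputable def Mu : Matrix (Fin D.NI ⊕ Fin D.NB) (Fin D.NI ⊕ Fin D.NB) ℝ :=
  Matrix.of fun i j => ∫ x in D.Ω, D.φ i x * D.φ j x

/-- The bulk stiffness matrix. -/
noncomputable def Ku : Matrix (Fin D.NI ⊕ Fin D.NB) (Fin D.NI ⊕ Fin D.NB) ℝ :=
  Matrix.of fun i j => ∫ x in D.Ω, D.α x * inner ℝ (gradient (D.φ i) x) (gradient (D.φ j) x)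

/-- The surface mass matrix. -/
noncomputable def Mp : Matrix (Fin D.Np) (Fin D.Np) ℝ :=
  Matrix.of fun i j => ∫ x, D.q i x * D.q j x ∂D.surf

/-- The surface stiffness matrix. -/
noncomputable def Kp : Matrix (Fin D.Np) (Fin D.Np) ℝ :=
  Matrix.of fun i j => ∑ s ∈ D.surfFacets, ∫ x in simplexHull s,
    D.κ x * inner ℝ (tangentialGradient s (D.q i) x) (tangentialGradient s (D.q j) x) ∂μHE[d - 1]

/-- The mass matrix of the multiplier space `M_h`. -/
noncomputable def Mlam : Matrix (Fin D.NB) (Fin D.NB) ℝ :=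
  Matrix.of fun i j => ∫ x, D.φ (Sum.inr i) x * D.φ (Sum.inr j) x ∂D.surf

/-- The matrix of the trace operator on `V_h`, tested with `M_h`. -/
noncomputable def Bu : Matrix (Fin D.NB) (Fin D.NI ⊕ Fin D.NB) ℝ :=
  Matrix.of fun i j => ∫ x, D.φ (Sum.inr i) x * D.φ j x ∂D.surf

/-- The matrix of the embedding of `Q_h`, tested with `M_h`. -/
noncomputable def Bp : Matrix (Fin D.NB) (Fin D.Np) ℝ :=
  Matrix.of fun i j => ∫ x, D.φ (Sum.inr i) x * D.q j x ∂D.surf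

end BulkSurfaceFE

/-- The squared norm `xᵀ A x`. -/
def sqNorm {ι : Type} [Fintype ι] (A : Matrix ι ι ℝ) (x : ι → ℝ) : ℝ := x ⬝ᵥ (A *ᵥ x)

/-- The difference of two consecutive members of a sequence, `x^n - x^{n-1}`. -/
def bdiff {ι : Type} (x : ℤ → ι → ℝ) (n : ℤ) : ι → ℝ := x n - x (n - 1)

/-- The BDF-2 difference quotient, `(3 x^n - 4 x^{n-1} + x^{n-2}) / (2τ)`. -/
noncomputable def bdf2 {ι : Type} (τ : ℝ) (x : ℤ → ι → ℝ) (n : ℤ) : ι → ℝ :=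
  (1 / (2 * τ)) • ((3 : ℝ) • x n - (4 : ℝ) • x (n - 1) + x (n - 2))

/-- The explicit difference quotient `(5 x^{n-1} - 8 x^{n-2} + 3 x^{n-3}) / (2τ)`, which
approximates the derivative at the `n`-th time point. -/
noncomputable def delayQuotient {ι : Type} (τ : ℝ) (x : ℤ → ι → ℝ) (n : ℤ) : ι → ℝ :=
  (1 / (2 * τ)) • ((5 : ℝ) • x (n - 1) - (8 : ℝ) • x (n - 2) + (3 : ℝ) • x (n - 3))

namespace BulkSurfaceFE

variable {d k : ℕ} (D : BulkSurfaceFE d k)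

/-- The auxiliary splitting scheme with step size `τ` and right-hand sides `fu`, `fp`, started
from consistent initial data: `û^{-1}, û^0` and `p^{-2}, p^{-1}, p^0` are the initial data, and for
every `n ≥ 1` the vectors `û^n = (û_1^n, û_2^n)`, `p^n`, `λ^n` satisfy the equations of the
scheme.  Values at smaller indices are irrelevant. -/
structure IsSolution (τ : ℝ) (fu : ℤ → Fin D.NI ⊕ Fin D.NB → ℝ) (fp : ℤ → Fin D.Np → ℝ)
    (u : ℤ → Fin D.NI ⊕ Fin D.NB → ℝ) (p : ℤ → Fin D.Np → ℝ) (lam : ℤ → Fin D.NB → ℝ) :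
    Prop where
  consistent_zero : D.Bu *ᵥ u 0 = D.Bp *ᵥ p 0
  consistent_neg_one : D.Bu *ᵥ u (-1) = D.Bp *ᵥ p (-1)
  eq_interior : ∀ n : ℤ, 1 ≤ n →
    D.Mu.toBlocks₁₁ *ᵥ bdf2 τ (fun j => u j ∘ Sum.inl) n + D.Ku.toBlocks₁₁ *ᵥ (u n ∘ Sum.inl) =
      fu n ∘ Sum.inl
        - D.Mu.toBlocks₁₂ *ᵥ (D.Mlam⁻¹ *ᵥ (D.Bp *ᵥ delayQuotient τ p n))
        - D.Ku.toBlocks₁₂ *ᵥ (D.Mlam⁻¹ *ᵥ (D.Bp *ᵥ ((2 : ℝ) • p (n - 1) - p (n - 2))))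
  eq_multiplier : ∀ n : ℤ, 1 ≤ n →
    D.Mu.toBlocks₂₁ *ᵥ bdf2 τ (fun j => u j ∘ Sum.inl) n + D.Ku.toBlocks₂₁ *ᵥ (u n ∘ Sum.inl)
        - D.Mlam *ᵥ lam n =
      fu n ∘ Sum.inr
        - D.Mu.toBlocks₂₂ *ᵥ (D.Mlam⁻¹ *ᵥ (D.Bp *ᵥ delayQuotient τ p n))
        - D.Ku.toBlocks₂₂ *ᵥ (D.Mlam⁻¹ *ᵥ (D.Bp *ᵥ ((2 : ℝ) • p (n - 1) - p (n - 2))))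
  eq_surface : ∀ n : ℤ, 1 ≤ n →
    D.Mp *ᵥ bdf2 τ p n + D.Kp *ᵥ p n + D.Bpᵀ *ᵥ lam n = fp n
  eq_trace : ∀ n : ℤ, 1 ≤ n → D.Mlam *ᵥ (u n ∘ Sum.inr) = D.Bp *ᵥ p n

/-- The bound in the stability estimate up to time step `m`: energy of the initial data and
contribution of the right-hand sides. -/
noncomputable def dataBound (cM τ : ℝ) (fu : ℤ → Fin D.NI ⊕ Fin D.NB → ℝ)
    (fp : ℤ → Fin D.Np → ℝ) (u : ℤ → Fin D.NI ⊕ Fin D.NB → ℝ) (p : ℤ → Fin D.Np → ℝ)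
    (m : ℤ) : ℝ :=
  sqNorm D.Ku (u 0) + sqNorm D.Kp (p 0)
    + τ / 2 * sqNorm D.Mu (τ⁻¹ • bdiff u 0)
    + τ / 2 * sqNorm D.Mp (τ⁻¹ • bdiff p 0)
    + 9 * cM * τ * D.h * sqNorm D.Mp (τ⁻¹ • bdiff (bdiff p) 0)
    + 2 * τ * ∑ j ∈ Finset.Icc 1 m, (sqNorm D.Mu⁻¹ (fu j) + sqNorm D.Mp⁻¹ (fp j))

/-- The energy part of the left-hand side of the stability estimate up to time step `m`, without
the second differences of `p`. -/
noncomputable def energy (τ : ℝ) (u : ℤ → Fin D.NI ⊕ Fin D.NB → ℝ) (p : ℤ → Fin D.Np → ℝ)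
    (m : ℤ) : ℝ :=
  sqNorm D.Ku (u m) + sqNorm D.Kp (p m)
    + τ * ∑ j ∈ Finset.Icc 1 m,
        (sqNorm D.Mu (τ⁻¹ • bdiff u j) + sqNorm D.Mp (τ⁻¹ • bdiff p j)
          + 1 / 2 * sqNorm D.Mu (τ⁻¹ • bdiff (bdiff u) j))
    + ∑ j ∈ Finset.Icc 1 m, sqNorm D.Kp (bdiff p j)

end BulkSurfaceFE

/-! The proof is an energy argument combined with trace-type inverse estimates in a boundary layer.

Since $2p^{n-1}-p^{n-2}=p^n-E^2p^n$ and $\widetilde D_\tau p^n=D_\tau p^n-\frac3{2\tau}E^3p^n$, the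
scheme is the fully implicit BDF-2 scheme perturbed by $K_u$ and $M_u$ applied to `lift` of $E^2p^n$
and $\frac3{2\tau}E^3p^n$, where `lift` extends the coefficients of the $L^2(\Gamma)$-projection by
zero to the interior nodes. Testing with $E\hat u^n$ and $Ep^n$, which have matching traces, removes
the multiplier (`IsSolution.tested`). The identity `dotProduct_bdf2` then produces the numerical
dissipation $\frac1{2\tau}\|E^2p^n\|_{M_p}^2$. Young's inequality leaves perturbations in terms of
$E^2p^n$ and $E^2p^{n-1}$ (`IsSolution.step`), which this dissipation absorbs when $h$ and $\tau/h$
are small. Summation over the steps gives the estimate.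

What makes the perturbations small is that a function without interior degrees of freedom lives on
the cells touching $\Gamma$. Its bulk mass is at most $c_Mh$ times the squared $L^2(\Gamma)$ norm of
its trace (`exists_mass_bound`), its energy at most $c_Kh^{-1}$ times that quantity
(`exists_stiffness_bound`), and the projection is a contraction (`sqNorm_Mlam_le`).

These bounds rest on three facts: a polynomial on a simplex is controlled by its nodal values
(`exists_nodal_bound`); a Markov inequality along segments gives gradient and inverse estimates
(`exists_gradient_bound`, `exists_inverse_bound`), without mapping to a reference element; and
quasi-uniformity limits the number of cells near a point by comparing volumes
(`card_le_of_packing`). -/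

/-! ### Polynomials of bounded degree -/

/-- A weak form of the Markov brothers' inequality on the unit interval. -/
theorem Polynomial.exists_derivative_bound (k : ℕ) : ∃ C > 0, ∀ p : Polynomial ℝ,
    p.natDegree ≤ k → ∀ M : ℝ, (∀ t ∈ Set.Icc (0 : ℝ) 1, |p.eval t| ≤ M) →
      ∀ t ∈ Set.Icc (0 : ℝ) 1, |p.derivative.eval t| ≤ C * M := by
  classical
  -- Interpolation at `k + 1` distinct points of the unit interval reproduces `p`, so the
  -- derivatives of the Lagrange basis give the constant. The denominator `k + 1` also covers `k =
  -- 0`.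
  set v : ℕ → ℝ := fun i => i / (k + 1) with hv
  have hinj : Set.InjOn v (Finset.range (k + 1)) := by
    intro i _ j _ hij
    have hk : (k : ℝ) + 1 ≠ 0 := by positivity
    simp only [hv] at hij
    field_simp at hij
    exact_mod_cast hij
  have hb : ∀ i, ∃ B, ∀ t ∈ Set.Icc (0 : ℝ) 1,
      ‖(Lagrange.basis (Finset.range (k + 1)) v i).derivative.eval t‖ ≤ B := fun i =>
    isCompact_Icc.exists_bound_of_continuousOn (Polynomial.continuous _).continuousOn
  choose B hB using hb
  have hB0 : ∀ i, 0 ≤ B i := fun i =>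
    (norm_nonneg _).trans (hB i 0 ⟨le_rfl, zero_le_one⟩)
  refine ⟨∑ i ∈ Finset.range (k + 1), B i + 1,
    add_pos_of_nonneg_of_pos (Finset.sum_nonneg fun i _ => hB0 i) one_pos, fun p hp M hM t ht => ?_⟩
  have hM0 : 0 ≤ M := (abs_nonneg _).trans (hM 0 ⟨le_rfl, zero_le_one⟩)
  have hdeg : p.degree < (Finset.range (k + 1)).card := by
    rw [Finset.card_range]
    exact (Polynomial.degree_le_of_natDegree_le hp).trans_lt (by exact_mod_cast Nat.lt_succ_self k)
  rw [Lagrange.eq_interpolate hinj hdeg, Lagrange.interpolate_apply, Polynomial.derivative_sum,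
    Polynomial.eval_finsetSum]
  refine (Finset.abs_sum_le_sum_abs _ _).trans ?_
  rw [add_mul, Finset.sum_mul]
  refine le_add_of_le_of_nonneg (Finset.sum_le_sum fun i hi => ?_) (by linarith)
  rw [Polynomial.derivative_C_mul, Polynomial.eval_C_mul, abs_mul, mul_comm]
  refine mul_le_mul (hB i t ht) (hM _ ⟨by positivity, ?_⟩) (abs_nonneg _) (hB0 i)
  simp only [hv]
  rw [div_le_one (by positivity)]
  exact_mod_cast (Finset.mem_range.1 hi).le

namespace MvPolynomial

/-- A polynomial of degree at most `k` vanishing at all lattice points with nonnegative coordinates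
of sum at most `k` is zero. -/
theorem eq_zero_of_eval_lattice {n k : ℕ} (Q : MvPolynomial (Fin n) ℝ) (hQ : Q.totalDegree ≤ k)
    (h : ∀ m : Fin n → ℕ, ∑ i, m i ≤ k → eval (fun i => (m i : ℝ)) Q = 0) : Q = 0 := by
  by_contra hne
  obtain ⟨t, ht, htd⟩ := Finset.exists_mem_eq_sup Q.support (support_nonempty.2 hne)
    fun s => s.sum fun _ e => e
  -- A monomial `t` of top degree forces a nonzero value on the grid with `i`-th coordinate in `{0,
  -- ..., t i}`. Coordinate sums on this grid are at most the degree, so it lies in the given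
  -- lattice.
  obtain ⟨s, hs, hs'⟩ := combinatorial_nullstellensatz_exists_eval_nonzero Q t
    (mem_support_iff.1 ht) htd (fun i => (Finset.range (t i + 1)).image fun j : ℕ => (j : ℝ))
    (fun i => by rw [Finset.card_image_of_injective _ Nat.cast_injective]; simp)
  simp only [Finset.mem_image, Finset.mem_range] at hs
  choose m hm hms using hs
  refine hs' ?_
  rw [show s = fun i => (m i : ℝ) from (_root_.funext hms).symm]
  refine h m ?_
  calc ∑ i, m i ≤ ∑ i, t i := Finset.sum_le_sum fun i _ => Nat.lt_succ_iff.1 (hm i)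
    _ = t.sum fun _ e => e := (Finsupp.sum_fintype t (fun _ e => e) fun _ => rfl).symm
    _ = Q.totalDegree := htd.symm
    _ ≤ k := hQ

/-- Evaluation at the finitely many lattice points is injective on polynomials of degree at most
`k`. A linear left inverse therefore writes `Q` as a combination of fixed polynomials with the
lattice values as coefficients, and these polynomials are bounded on the cube. -/
theorem exists_lattice_bound (n k : ℕ) : ∃ C > 0, ∀ Q : MvPolynomial (Fin n) ℝ,
    Q.totalDegree ≤ k → ∀ M : ℝ, 0 ≤ M →
      (∀ m : Fin n → ℕ, ∑ i, m i ≤ k → |eval (fun i => (m i : ℝ)) Q| ≤ M) →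
      ∀ y : Fin n → ℝ, (∀ i, y i ∈ Set.Icc (0 : ℝ) k) → |eval y Q| ≤ C * M := by
  classical
  let S : Finset (Fin n → ℕ) :=
    (Fintype.piFinset fun _ => Finset.range (k + 1)).filter fun m => ∑ i, m i ≤ k
  have hS : ∀ m : Fin n → ℕ, m ∈ S ↔ ∑ i, m i ≤ k := by
    intro m
    simp only [S, Finset.mem_filter, Fintype.mem_piFinset, Finset.mem_range, and_iff_right_iff_imp]
    exact fun h i => Nat.lt_succ_iff.2
      ((Finset.single_le_sum (fun _ _ => Nat.zero_le _) (Finset.mem_univ i)).trans h)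
  let E : restrictTotalDegree (Fin n) ℝ k →ₗ[ℝ] (S → ℝ) :=
    LinearMap.pi fun m => (aeval (fun i => (m.1 i : ℝ))).toLinearMap.comp (Submodule.subtype _)
  have hE : ∀ Q m, E Q m = eval (fun i => (m.1 i : ℝ)) Q.1 := fun Q m => by
    simp [E, aeval_eq_eval]
  have hker : LinearMap.ker E = ⊥ := by
    refine LinearMap.ker_eq_bot'.2 fun Q hQ => Subtype.ext ?_
    refine eq_zero_of_eval_lattice Q.1 ((mem_restrictTotalDegree _ _ _).1 Q.2) fun m hm => ?_
    rw [← hE Q ⟨m, (hS m).2 hm⟩, hQ, Pi.zero_apply]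
  obtain ⟨G, hG⟩ := E.exists_leftInverse_of_injective hker
  have hb : ∀ m : S, ∃ B, ∀ y ∈ Set.univ.pi fun _ : Fin n => Set.Icc (0 : ℝ) k,
      ‖eval y (G (Pi.single m 1)).1‖ ≤ B := fun m =>
    (isCompact_univ_pi fun _ => isCompact_Icc).exists_bound_of_continuousOn
      (continuous_eval _).continuousOn
  choose B hB using hb
  have hB0 : ∀ m, 0 ≤ B m := fun m =>
    (norm_nonneg _).trans (hB m 0 fun i _ => ⟨le_rfl, Nat.cast_nonneg k⟩)
  refine ⟨∑ m, B m + 1, add_pos_of_nonneg_of_pos (Finset.sum_nonneg fun i _ => hB0 i) one_pos,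
    fun Q hQ M hM0 hM y hy => ?_⟩
  let Q' : restrictTotalDegree (Fin n) ℝ k := ⟨Q, (mem_restrictTotalDegree _ _ _).2 hQ⟩
  have h1 : Q' = ∑ m, E Q' m • G (Pi.single m 1) := by
    conv_lhs => rw [← LinearMap.id_apply (R := ℝ) Q', ← hG, LinearMap.comp_apply,
      LinearMap.pi_apply_eq_sum_univ G (E Q')]
    refine Finset.sum_congr rfl fun m _ => ?_
    congr 2
    ext j
    simp [Pi.single_apply, eq_comm]
  have h2 : eval y Q = ∑ m, E Q' m * eval y (G (Pi.single m 1)).1 := by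
    have := congrArg (fun R : restrictTotalDegree (Fin n) ℝ k => eval y R.1) h1
    simpa [Q', smul_eval] using this
  rw [h2]
  refine (Finset.abs_sum_le_sum_abs _ _).trans ?_
  rw [add_mul, Finset.sum_mul]
  refine le_add_of_le_of_nonneg (Finset.sum_le_sum fun m _ => ?_) (by linarith)
  rw [abs_mul, mul_comm, hE]
  exact mul_le_mul (hB m y fun i _ => hy i) (hM _ ((hS _).1 m.2)) (abs_nonneg _) (hB0 m)

/-- The restriction of a polynomial to a line. -/
theorem exists_polynomial_on_line {d k : ℕ} (P : MvPolynomial (Fin d) ℝ) (hP : P.totalDegree ≤ k)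
    (x w : Fin d → ℝ) : ∃ p : Polynomial ℝ, p.natDegree ≤ k ∧
      ∀ t : ℝ, p.eval t = eval (fun i => x i + t * w i) P := by
  let f : Fin d → Polynomial ℝ := fun i => Polynomial.C (x i) + Polynomial.X * Polynomial.C (w i)
  have hf : ∀ i, (f i).natDegree ≤ 1 := fun i => by
    refine (Polynomial.natDegree_add_le _ _).trans (max_le (by simp) ?_)
    exact (Polynomial.natDegree_mul_C_le _ _).trans Polynomial.natDegree_X_le
  refine ⟨aeval f P, (aeval_natDegree_le P hP f hf).trans (mul_one k).le, fun t => ?_⟩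
  rw [← Polynomial.coe_aeval_eq_eval, ← aeval_eq_eval, comp_aeval_apply]
  simp only [f, map_add, map_mul, Polynomial.aeval_C, Polynomial.aeval_X, Algebra.algebraMap_self,
    RingHom.id_apply]

theorem totalDegree_aeval_le {σ τ : Type*} {k : ℕ} (F : MvPolynomial σ ℝ) (hF : F.totalDegree ≤ k)
    (f : σ → MvPolynomial τ ℝ) (hf : ∀ i, (f i).totalDegree ≤ 1) :
    (aeval f F).totalDegree ≤ k := by
  rw [aeval_def, eval₂]
  refine totalDegree_finsetSum_le fun m hm => ?_
  refine (totalDegree_mul _ _).trans ?_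
  rw [algebraMap_eq, totalDegree_C, zero_add]
  refine (totalDegree_finsetProd _ _).trans ?_
  refine (Finset.sum_le_sum fun i _ => (totalDegree_pow _ _).trans
    (Nat.mul_le_mul_left _ (hf i))).trans ?_
  simp only [mul_one]
  exact (le_totalDegree hm).trans hF

/-- The composition of a polynomial with an affine map. -/
theorem exists_affine_comp {d n k : ℕ} (P : MvPolynomial (Fin d) ℝ) (hP : P.totalDegree ≤ k)
    (x : Fin d → ℝ) (w : Fin n → Fin d → ℝ) : ∃ Q : MvPolynomial (Fin n) ℝ, Q.totalDegree ≤ k ∧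
      ∀ y : Fin n → ℝ, eval y Q = eval (fun i => x i + ∑ j, y j * w j i) P := by
  refine ⟨aeval (fun i => C (x i) + ∑ j, X j * C (w j i)) P, totalDegree_aeval_le P hP _ fun i => ?_,
    fun y => ?_⟩
  · refine (totalDegree_add _ _).trans (max_le (by simp) (totalDegree_finsetSum_le fun j _ => ?_))
    exact (totalDegree_mul _ _).trans (by simp)
  · rw [← aeval_eq_eval, ← aeval_eq_eval, comp_aeval_apply]
    simp

end MvPolynomial

/-! ### Piecewise polynomials on simplices -/

namespace IsPolyOn

variable {d k : ℕ} {v w : Euc d → ℝ} {S T : Set (Euc d)}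

theorem sum_mul {ι : Type*} (s : Finset ι) (c : ι → ℝ) (f : ι → Euc d → ℝ)
    (h : ∀ i, IsPolyOn k (f i) S) : IsPolyOn k (fun x => ∑ i ∈ s, c i * f i x) S := by
  choose P hP hv using h
  refine ⟨∑ i ∈ s, MvPolynomial.C (c i) * P i,
    MvPolynomial.totalDegree_finsetSum_le fun i _ => ?_, fun x hx => ?_⟩
  · exact (MvPolynomial.totalDegree_mul _ _).trans (by simpa using hP i)
  · simp only [map_sum, map_mul, MvPolynomial.eval_C]
    exact Finset.sum_congr rfl fun i _ => by rw [hv i x hx]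

theorem continuousOn (h : IsPolyOn k v S) : ContinuousOn v S := by
  obtain ⟨P, -, hv⟩ := h
  refine ContinuousOn.congr (f := fun x : Euc d => MvPolynomial.eval (fun i => x i) P) ?_ hv
  exact ((MvPolynomial.continuous_eval P).comp (by fun_prop)).continuousOn

end IsPolyOn

theorem MvPolynomial.contDiff_eval_euclidean {d : ℕ} (P : MvPolynomial (Fin d) ℝ) :
    ContDiff ℝ ⊤ fun x : Euc d => MvPolynomial.eval (fun i => x i) P := by
  refine AnalyticOnNhd.contDiff ?_
  exact AnalyticOnNhd.eval_linearMap' (fun i => (EuclideanSpace.proj i : Euc d →L[ℝ] ℝ).toLinearMap) P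

theorem isCompact_simplexHull {d : ℕ} (s : Finset (Euc d)) : IsCompact (simplexHull s) :=
  s.finite_toSet.isCompact_convexHull ℝ

theorem convex_simplexHull {d : ℕ} (s : Finset (Euc d)) : Convex ℝ (simplexHull s) :=
  convex_convexHull ℝ _

/-- A polynomial on a simplex is controlled by its values at the Lagrange nodes. -/
theorem exists_nodal_bound (n k : ℕ) (hk : 1 ≤ k) : ∃ C > 0, ∀ (d : ℕ) (s : Finset (Euc d)),
    s.card = n + 1 → ∀ v : Euc d → ℝ, IsPolyOn k v (simplexHull s) → ∀ M : ℝ, 0 ≤ M →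
      (∀ m : Euc d → ℕ, ∑ a ∈ s, m a = k → |v (∑ a ∈ s, ((m a : ℝ) / (k : ℝ)) • a)| ≤ M) →
      ∀ x ∈ simplexHull s, |v x| ≤ C * M := by
  classical
  obtain ⟨C, hC, H⟩ := MvPolynomial.exists_lattice_bound n k
  refine ⟨C, hC, fun d s hs v ⟨P, hP, hv⟩ M hM0 hM x hx => ?_⟩
  have hk0 : (k : ℝ) ≠ 0 := by positivity
  let e : s ≃ Fin (n + 1) := s.equivFinOfCardEq hs
  let a : Fin (n + 1) → Euc d := fun j => (e.symm j : Euc d)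
  have hsum : ∀ {E : Type} [AddCommMonoid E] (f : Euc d → E), ∑ b ∈ s, f b = ∑ j, f (a j) := by
    intro E _ f
    rw [← Finset.sum_coe_sort s f]
    exact (Equiv.sum_comp e.symm fun b : s => f b).symm
  obtain ⟨Q, hQ, hQe⟩ := MvPolynomial.exists_affine_comp P hP (fun i => a 0 i)
    (fun (j : Fin n) i => (a j.succ i - a 0 i) / k)
  -- Barycentric coordinates scaled by `k`, with the one of vertex `0` dropped, turn Lagrange nodes
  -- into lattice points. The polynomial `Q` has `n` variables, so the constant does not depend on
  -- the ambient dimension.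
  have key : ∀ c : Fin (n + 1) → ℝ, ∑ j, c j = k →
      MvPolynomial.eval (fun j : Fin n => c j.succ) Q =
        MvPolynomial.eval (fun i => (∑ j, (c j / k) • a j) i) P := by
    intro c hc
    rw [hQe]
    congr 2
    ext i
    rw [Fin.sum_univ_succ] at hc
    have h0 : c 0 = k - ∑ j : Fin n, c j.succ := by linarith
    rw [Fin.sum_univ_succ]
    simp only [WithLp.ofLp_add, WithLp.ofLp_sum, WithLp.ofLp_smul, Pi.add_apply, Finset.sum_apply,
      Pi.smul_apply, smul_eq_mul]
    rw [h0, sub_div, div_self hk0, sub_mul, one_mul, Finset.sum_div, Finset.sum_mul, sub_add,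
      ← Finset.sum_sub_distrib, sub_eq_add_neg, ← Finset.sum_neg_distrib]
    congr 1
    exact Finset.sum_congr rfl fun j _ => by ring
  have hmem : ∀ c : Fin (n + 1) → ℝ, (∀ j, 0 ≤ c j) → ∑ j, c j = k →
      ∑ j, (c j / k) • a j ∈ simplexHull s := by
    intro c hc0 hc
    refine (convex_convexHull ℝ _).sum_mem (fun j _ => div_nonneg (hc0 j) (Nat.cast_nonneg k)) ?_
      fun j _ => subset_convexHull ℝ _ (e.symm j).2
    rw [← Finset.sum_div, hc, div_self hk0]
  rw [simplexHull, Finset.convexHull_eq] at hx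
  obtain ⟨w, hw0, hw1, hwx⟩ := hx
  rw [Finset.centerMass_eq_of_sum_1 _ _ hw1] at hwx
  have hw1' : ∑ j, (k : ℝ) * w (a j) = k := by
    rw [← Finset.mul_sum, ← hsum, hw1, mul_one]
  have hnn : ∀ j, 0 ≤ (k : ℝ) * w (a j) := fun j =>
    mul_nonneg (Nat.cast_nonneg k) (hw0 _ (e.symm j).2)
  have hx' : x = ∑ j, ((k : ℝ) * w (a j) / k) • a j := by
    rw [← hwx, hsum]
    exact Finset.sum_congr rfl fun j _ => by rw [mul_div_cancel_left₀ _ hk0]; rfl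
  have hxm := hmem _ hnn hw1'
  rw [← hx'] at hxm
  rw [hv x hxm, hx', ← key _ hw1']
  refine H Q hQ M hM0 (fun m hm => ?_) _ fun j => ⟨hnn _, ?_⟩
  · let c : Fin (n + 1) → ℕ := Fin.cons (k - ∑ i, m i) m
    have hc : ∑ j, c j = k := by
      rw [Fin.sum_univ_succ]
      simp only [c, Fin.cons_zero, Fin.cons_succ]
      omega
    let m' : Euc d → ℕ := fun b => if h : b ∈ s then c (e ⟨b, h⟩) else 0
    have hm' : ∀ j, m' (a j) = c j := fun j => by simp [m', a]
    have h1 := hM m' (by rw [hsum]; simp_rw [hm']; exact hc)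
    rw [hsum] at h1
    simp_rw [hm'] at h1
    have hc' : ∑ j, (c j : ℝ) = k := by exact_mod_cast hc
    rw [hv _ (hmem _ (fun j => Nat.cast_nonneg _) hc'), ← key _ hc'] at h1
    simpa [c] using h1
  · refine le_of_le_of_eq ?_ hw1'
    exact Finset.single_le_sum (f := fun j => (k : ℝ) * w (a j)) (fun j _ => hnn j)
      (Finset.mem_univ j.succ)

/-- The derivative of a polynomial in direction of another point of a convex set. -/
theorem exists_directional_bound (k : ℕ) : ∃ C > 0, ∀ (d : ℕ) (S : Set (Euc d)), Convex ℝ S →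
    ∀ P : MvPolynomial (Fin d) ℝ, P.totalDegree ≤ k → ∀ M : ℝ,
      (∀ x ∈ S, |MvPolynomial.eval (fun i => x i) P| ≤ M) → ∀ x ∈ S, ∀ y ∈ S,
        (∀ t ∈ Set.Icc (0 : ℝ) 1, |MvPolynomial.eval (fun i => AffineMap.lineMap x y t i) P
          - MvPolynomial.eval (fun i => x i) P| ≤ C * M * t) ∧
        |fderiv ℝ (fun x : Euc d => MvPolynomial.eval (fun i => x i) P) x (y - x)| ≤ C * M := by
  obtain ⟨C, hC, H⟩ := Polynomial.exists_derivative_bound k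
  refine ⟨C, hC, fun d S hS P hP M hM x hx y hy => ?_⟩
  obtain ⟨p, hp, hpe⟩ := MvPolynomial.exists_polynomial_on_line P hP (fun i => x i)
    (fun i => (y - x) i)
  have hpl : ∀ t : ℝ, p.eval t = MvPolynomial.eval (fun i => AffineMap.lineMap x y t i) P := by
    intro t
    rw [hpe]
    congr 2
    ext i
    simp [AffineMap.lineMap_apply, add_comm]
  have hb := H p hp M fun t ht => by
    rw [hpl]
    exact hM _ (hS.segment_subset hx hy
      (by rw [segment_eq_image_lineMap]; exact Set.mem_image_of_mem _ ht))
  have h0 : p.eval 0 = MvPolynomial.eval (fun i => x i) P := by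
    rw [hpl]; simp
  refine ⟨fun t ht => ?_, ?_⟩
  · have := (convex_Icc (0 : ℝ) 1).norm_image_sub_le_of_norm_deriv_le
      (f := fun t => p.eval t) (C := C * M) (fun t _ => p.differentiableAt)
      (fun t ht => by rw [Polynomial.deriv]; exact hb t ht) ⟨le_rfl, zero_le_one⟩ ht
    rw [← hpl, ← h0]
    simpa [abs_of_nonneg ht.1] using this
  · have hd : HasDerivAt (fun t : ℝ => p.eval t)
        (fderiv ℝ (fun x : Euc d => MvPolynomial.eval (fun i => x i) P) x (y - x)) 0 := by
      have h1 : HasFDerivAt (fun x : Euc d => MvPolynomial.eval (fun i => x i) P)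
          (fderiv ℝ (fun x : Euc d => MvPolynomial.eval (fun i => x i) P) x)
          (AffineMap.lineMap x y (0 : ℝ)) := by
        rw [AffineMap.lineMap_apply_zero]
        exact (P.contDiff_eval_euclidean.differentiable (by simp) x).hasFDerivAt
      have h2 := h1.comp_hasDerivAt (0 : ℝ) (AffineMap.hasDerivAt_lineMap (a := x) (b := y))
      exact h2.congr_of_eventuallyEq (Filter.Eventually.of_forall hpl)
    rw [← hd.deriv, Polynomial.deriv]
    exact hb 0 ⟨le_rfl, zero_le_one⟩

/-- Inverse estimate for the gradient. -/
theorem exists_gradient_bound (k : ℕ) : ∃ C > 0, ∀ (d : ℕ) (S : Set (Euc d)), Convex ℝ S →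
    ∀ P : MvPolynomial (Fin d) ℝ, P.totalDegree ≤ k → ∀ M : ℝ,
      (∀ x ∈ S, |MvPolynomial.eval (fun i => x i) P| ≤ M) → ∀ c r, 0 < r →
      Metric.closedBall c r ⊆ S → ∀ x ∈ S,
        ‖gradient (fun x : Euc d => MvPolynomial.eval (fun i => x i) P) x‖ ≤ C * M / r := by
  obtain ⟨C, hC, H⟩ := exists_directional_bound k
  refine ⟨C, hC, fun d S hS P hP M hM c r hr hc x hx => ?_⟩
  have hM0 : 0 ≤ M := (abs_nonneg _).trans (hM x hx)
  rw [gradient, LinearIsometryEquiv.norm_map]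
  set L := fderiv ℝ (fun x : Euc d => MvPolynomial.eval (fun i => x i) P) x
  refine ContinuousLinearMap.opNorm_le_of_unit_norm (by positivity) fun e he => ?_
  have hmem : ∀ t : ℝ, |t| = r → c + t • e ∈ S := fun t ht => hc (by
    rw [mem_closedBall_iff_norm, add_sub_cancel_left, norm_smul, he, mul_one]
    exact ht.le)
  -- The directional bound applies only towards points of `S`. The difference of the directions from
  -- `x` to two opposite points of the ball is `2 * r * e`, whatever the position of `x`.
  have h1 := (H d S hS P hP M hM x hx _ (hmem r (abs_of_pos hr))).2
  have h2 := (H d S hS P hP M hM x hx _ (hmem (-r) (by rw [abs_neg, abs_of_pos hr]))).2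
  have h3 : L (c + r • e - x) - L (c + (-r) • e - x) = 2 * r * L e := by
    rw [← map_sub, show c + r • e - x - (c + (-r) • e - x) = (2 * r) • e by module, map_smul,
      smul_eq_mul]
  rw [le_div_iff₀ hr, Real.norm_eq_abs]
  have h4 : |2 * r * L e| ≤ C * M + C * M := by
    rw [← h3]
    exact (abs_sub _ _).trans (add_le_add h1 h2)
  rw [abs_mul, abs_of_pos (by positivity : 0 < 2 * r)] at h4
  linarith

/-- Inverse estimate: a polynomial on a simplex is bounded pointwise by its `L²` norm. -/
theorem exists_inverse_bound (n k : ℕ) : ∃ C > 0, ∀ (d : ℕ) (s : Finset (Euc d)) (v : Euc d → ℝ),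
    IsPolyOn k v (simplexHull s) → μHE[n] (simplexHull s) ≠ ⊤ → ∀ x ∈ simplexHull s,
      v x ^ 2 * (μHE[n] (simplexHull s)).toReal ≤ C * ∫ y in simplexHull s, v y ^ 2 ∂μHE[n] := by
  obtain ⟨C, hC, H⟩ := exists_directional_bound k
  -- A contraction of ratio `r` towards a maximum point stays in the simplex and changes the value
  -- by at most half of the maximum.
  set r : ℝ := min 1 (1 / (2 * C)) with hr
  have hr0 : 0 < r := by positivity
  refine ⟨4 / r ^ n, by positivity, fun d s v hv hfin x hx => ?_⟩
  set T := simplexHull s with hT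
  obtain ⟨x₀, hx₀, hmax⟩ := (isCompact_simplexHull s).exists_isMaxOn ⟨x, hx⟩
    (continuous_abs.comp_continuousOn hv.continuousOn)
  set M := |v x₀| with hM
  have hmax' : ∀ y ∈ T, |v y| ≤ M := fun y hy => hmax hy
  have hint : IntegrableOn (fun y => v y ^ 2) T μHE[n] := by
    refine ⟨((hv.continuousOn.pow 2).aestronglyMeasurable
      (isCompact_simplexHull s).isClosed.measurableSet), ?_⟩
    refine HasFiniteIntegral.restrict_of_bounded (C := M ^ 2) hfin.lt_top ?_
    filter_upwards [ae_restrict_mem (isCompact_simplexHull s).isClosed.measurableSet] with y hy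
    rw [Real.norm_eq_abs, abs_pow]
    gcongr
    exact hmax' y hy
  -- On this shrunken copy `|v|` is at least `M / 2`, and its measure is `r ^ n` times that of `T`.
  -- The integral over the copy alone gives the bound.
  set S := AffineMap.homothety x₀ r '' T with hS
  have hST : ∀ y ∈ S, y ∈ T ∧ M / 2 ≤ |v y| := by
    rintro _ ⟨z, hz, rfl⟩
    rw [AffineMap.homothety_eq_lineMap]
    have hmem : AffineMap.lineMap x₀ z r ∈ T := (convex_simplexHull s).segment_subset hx₀ hz
      (by rw [segment_eq_image_lineMap]
          exact Set.mem_image_of_mem _ ⟨hr0.le, min_le_left _ _⟩)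
    refine ⟨hmem, ?_⟩
    obtain ⟨P, hP, hPv⟩ := hv
    have h1 := (H d T (convex_simplexHull s) P hP M (fun y hy => by rw [← hPv y hy]; exact hmax' y hy)
      x₀ hx₀ z hz).1 r ⟨hr0.le, min_le_left _ _⟩
    rw [← hPv _ hmem, ← hPv _ hx₀] at h1
    have h2 : C * M * r ≤ M / 2 := by
      calc C * M * r ≤ C * M * (1 / (2 * C)) := by
            gcongr
            exact min_le_right _ _
        _ = M / 2 := by field_simp
    have h3 := abs_sub_abs_le_abs_sub (v x₀) (v (AffineMap.lineMap x₀ z r))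
    rw [abs_sub_comm] at h3
    linarith
  have hScomp : IsCompact S := (isCompact_simplexHull s).image
    (AffineMap.homothety_continuous x₀ r)
  have hSm : MeasurableSet S := hScomp.isClosed.measurableSet
  have hSvol : (μHE[n] S).toReal = r ^ n * (μHE[n] T).toReal := by
    rw [hS, euclideanHausdorffMeasure_homothety_image n x₀ hr0.ne']
    simp [abs_of_pos hr0]
  have h4 : (M / 2) ^ 2 * (μHE[n] S).toReal ≤ ∫ y in S, v y ^ 2 ∂μHE[n] := by
    have hSf : μHE[n] S ≠ ⊤ := ne_top_of_le_ne_top hfin (measure_mono fun y hy => (hST y hy).1)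
    have := setIntegral_mono_on (μ := μHE[n]) (s := S) (f := fun _ => (M / 2) ^ 2)
      (g := fun y => v y ^ 2) (integrableOn_const hSf) (hint.mono_set fun y hy => (hST y hy).1) hSm
      fun y hy => by
        rw [← sq_abs (v y)]
        have := (hST y hy).2
        gcongr
    rw [setIntegral_const, smul_eq_mul, mul_comm] at this
    exact this
  have h5 : ∫ y in S, v y ^ 2 ∂μHE[n] ≤ ∫ y in T, v y ^ 2 ∂μHE[n] :=
    setIntegral_mono_set hint (Filter.Eventually.of_forall fun y => sq_nonneg _)
      (LE.le.eventuallyLE fun y hy => (hST y hy).1)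
  rw [hSvol] at h4
  have h6 : v x ^ 2 ≤ M ^ 2 := by
    rw [← sq_abs (v x)]
    have := hmax' x hx
    gcongr
  rw [div_mul_eq_mul_div, le_div_iff₀ (by positivity)]
  calc v x ^ 2 * (μHE[n] T).toReal * r ^ n ≤ M ^ 2 * (μHE[n] T).toReal * r ^ n := by gcongr
    _ = 4 * ((M / 2) ^ 2 * (r ^ n * (μHE[n] T).toReal)) := by ring
    _ ≤ _ := by linarith

/-! ### The Euclidean Hausdorff measure of simplices -/

theorem LipschitzWith.euclideanHausdorffMeasure_image_le {X Y : Type*} [EMetricSpace X]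
    [MeasurableSpace X] [BorelSpace X] [EMetricSpace Y] [MeasurableSpace Y] [BorelSpace Y]
    {f : X → Y} (hf : LipschitzWith 1 f) (n : ℕ) (s : Set X) : μHE[n] (f '' s) ≤ μHE[n] s := by
  simp only [Measure.euclideanHausdorffMeasure_def, Measure.smul_apply]
  gcongr
  simpa using hf.hausdorffMeasure_image_le (Nat.cast_nonneg n) s

section Parametrization

variable {d : ℕ} {s : Finset (Euc d)} {x : Euc d}

/-- The part of the tangent space of a simplex that parametrizes the simplex. -/
def tangentSimplex (s : Finset (Euc d)) (x : Euc d) : Set (vectorSpan ℝ (s : Set (Euc d))) :=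
  {v | x + (v : Euc d) ∈ simplexHull s}

theorem isometry_add_coe (W : Submodule ℝ (Euc d)) (x : Euc d) :
    Isometry fun v : W => x + (v : Euc d) :=
  (IsometryEquiv.addLeft x).isometry.comp W.subtypeₗᵢ.isometry

theorem vectorSpan_simplexHull (s : Finset (Euc d)) :
    vectorSpan ℝ (simplexHull s) = vectorSpan ℝ (s : Set (Euc d)) := by
  rw [simplexHull, ← direction_affineSpan, affineSpan_convexHull, direction_affineSpan]

theorem image_tangentSimplex (hx : x ∈ simplexHull s) :
    (fun v : vectorSpan ℝ (s : Set (Euc d)) => x + (v : Euc d)) '' tangentSimplex s x =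
      simplexHull s := by
  refine Set.Subset.antisymm (by rintro _ ⟨v, hv, rfl⟩; exact hv) fun y hy => ?_
  have hyx : y - x ∈ vectorSpan ℝ (s : Set (Euc d)) := by
    rw [← vectorSpan_simplexHull]
    exact vsub_mem_vectorSpan ℝ hy hx
  exact ⟨⟨y - x, hyx⟩, by simpa [tangentSimplex] using hy, by simp⟩

theorem convex_tangentSimplex (s : Finset (Euc d)) (x : Euc d) :
    Convex ℝ (tangentSimplex s x) :=
  ((convex_simplexHull s).translate_preimage_right x).linear_preimage
    (vectorSpan ℝ (s : Set (Euc d))).subtype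

theorem isCompact_tangentSimplex (s : Finset (Euc d)) (x : Euc d) :
    IsCompact (tangentSimplex s x) :=
  (isometry_add_coe _ x).isClosedEmbedding.isCompact_preimage (isCompact_simplexHull s)

/-- A convex set has interior once it spans affinely, and the inclusion maps the direction of its
span onto the whole tangent space. -/
theorem interior_tangentSimplex_nonempty (hx : x ∈ simplexHull s) :
    (interior (tangentSimplex s x)).Nonempty := by
  have h0 : (0 : vectorSpan ℝ (s : Set (Euc d))) ∈ tangentSimplex s x := by
    simpa [tangentSimplex] using hx
  rw [(convex_tangentSimplex s x).interior_nonempty_iff_affineSpan_eq_top,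
    ← AffineSubspace.direction_eq_top_iff_of_nonempty ((affineSpan_nonempty ℝ).2 ⟨0, h0⟩),
    direction_affineSpan]
  let f : vectorSpan ℝ (s : Set (Euc d)) →ᵃ[ℝ] Euc d :=
    (AffineEquiv.constVAdd ℝ (Euc d) x).toAffineMap.comp
      (vectorSpan ℝ (s : Set (Euc d))).subtype.toAffineMap
  have hf : f '' tangentSimplex s x = simplexHull s := image_tangentSimplex hx
  have hlin : f.linear = (vectorSpan ℝ (s : Set (Euc d))).subtype := by
    ext v; simp [f]
  have h1 := AffineMap.map_vectorSpan (f := f) (s := tangentSimplex s x)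
  rw [hf, vectorSpan_simplexHull, hlin] at h1
  refine Submodule.map_injective_of_injective
    (vectorSpan ℝ (s : Set (Euc d))).injective_subtype ?_
  rw [h1, Submodule.map_subtype_top]

variable {n : ℕ}

/-- The isometric parametrization over the tangent space reduces the claim to a compact set with
nonempty interior in a space of dimension `n`. -/
theorem measure_simplexHull_pos_and_lt_top (hs : AffineIndependent ℝ ((↑) : s → Euc d))
    (hcard : s.card = n + 1) :
    0 < μHE[n] (simplexHull s) ∧ μHE[n] (simplexHull s) < ⊤ := by
  obtain ⟨x, hxs⟩ : s.Nonempty := Finset.card_pos.1 (by omega)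
  have hx : x ∈ simplexHull s := subset_convexHull ℝ _ hxs
  have hrank : Module.finrank ℝ (vectorSpan ℝ (s : Set (Euc d))) = n := by
    have := hs.finrank_vectorSpan (n := n) (by simpa using hcard)
    rwa [Subtype.range_coe_subtype] at this
  have h := (isometry_add_coe (vectorSpan ℝ (s : Set (Euc d))) x).euclideanHausdorffMeasure_image
    (d := n) (tangentSimplex s x)
  rw [image_tangentSimplex hx] at h
  rw [h, ← hrank]
  exact ⟨(isOpen_interior.measure_pos _ (interior_tangentSimplex_nonempty hx)).trans_le
    (measure_mono interior_subset), (isCompact_tangentSimplex s x).measure_lt_top⟩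

end Parametrization

/-- The facets of a simplex that contains a ball are not too small. -/
theorem le_measure_facet {n : ℕ} {F : Finset (Euc (n + 1))} {a c : Euc (n + 1)} {r : ℝ}
    (hF : F.Nonempty) (ha : a ∉ F)
    (hball : Metric.closedBall c r ⊆ convexHull ℝ (insert a (F : Set (Euc (n + 1))))) :
    volume (Metric.closedBall (0 : Euc n) r) ≤ μHE[n] (simplexHull F) := by
  obtain ⟨b, hb⟩ := hF
  have he : a - b ≠ 0 := fun h => ha (by rwa [sub_eq_zero.1 h])
  have : Fact (Module.finrank ℝ (Euc (n + 1)) = n + 1) := ⟨by simp⟩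
  -- The projection along an edge `a - b` with `b ∈ F` sends the apex to the image of `b`, so
  -- simplex and facet have the same image. This image contains an `n`-dimensional ball of radius
  -- `r`, and projecting does not increase measure.
  let W : Submodule ℝ (Euc (n + 1)) := (Submodule.span ℝ {a - b})ᗮ
  let g : Euc n ≃ₗᵢ[ℝ] W := (OrthonormalBasis.fromOrthogonalSpanSingleton n he).repr.symm
  let π : Euc (n + 1) →L[ℝ] W := W.orthogonalProjectionOnto
  have hπ : LipschitzWith 1 π := by
    refine (ContinuousLinearMap.lipschitz π).weaken ?_
    exact_mod_cast Submodule.orthogonalProjectionOnto_norm_le W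
  have hab : π a = π b := by
    rw [← sub_eq_zero, ← map_sub]
    exact Submodule.orthogonalProjectionOnto_orthogonal_apply_eq_zero
      (Submodule.mem_span_singleton_self _)
  have himg : π '' convexHull ℝ (insert a (F : Set (Euc (n + 1)))) = π '' simplexHull F := by
    have h1 := LinearMap.image_convexHull (π : Euc (n + 1) →ₗ[ℝ] W)
      (insert a (F : Set (Euc (n + 1))))
    have h2 := LinearMap.image_convexHull (π : Euc (n + 1) →ₗ[ℝ] W) (F : Set (Euc (n + 1)))
    simp only [ContinuousLinearMap.coe_coe] at h1 h2
    rw [simplexHull, h1, h2, Set.image_insert_eq, hab,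
      Set.insert_eq_of_mem (Set.mem_image_of_mem _ (Finset.mem_coe.2 hb))]
  have hiso : Isometry fun z : Euc n => π c + g z :=
    (IsometryEquiv.addLeft (π c)).isometry.comp g.isometry
  have hsub : (fun z : Euc n => π c + g z) '' Metric.closedBall 0 r ⊆ π '' simplexHull F := by
    rw [← himg]
    rintro _ ⟨z, hz, rfl⟩
    refine ⟨c + (g z : Euc (n + 1)), hball ?_, ?_⟩
    · rw [mem_closedBall_iff_norm, add_sub_cancel_left, ← Submodule.coe_norm, g.norm_map]
      simpa using hz
    · rw [map_add]
      congr 1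
      exact Submodule.orthogonalProjectionOnto_mem_subspace_eq_self (g z)
  calc volume (Metric.closedBall (0 : Euc n) r)
      = μHE[n] ((fun z : Euc n => π c + g z) '' Metric.closedBall 0 r) := by
        rw [hiso.euclideanHausdorffMeasure_image, EuclideanSpace.euclideanHausdorffMeasure_eq_volume]
    _ ≤ μHE[n] (π '' simplexHull F) := measure_mono hsub
    _ ≤ μHE[n] (simplexHull F) := hπ.euclideanHausdorffMeasure_image_le n _

/-- Two distinct simplices of full dimension in a simplicial complex overlap in a null set. -/
theorem Geometry.SimplicialComplex.volume_inter_eq_zero {d : ℕ}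
    (K : Geometry.SimplicialComplex ℝ (Euc d)) {s t : Finset (Euc d)} (hs : s ∈ K.faces)
    (ht : t ∈ K.faces) (hcard : s.card = t.card) (hst : s ≠ t) :
    volume (simplexHull s ∩ simplexHull t) = 0 := by
  classical
  obtain ⟨a, has, hat⟩ : ∃ a ∈ s, a ∉ t := by
    by_contra! h
    exact hst (Finset.eq_of_subset_of_card_le h hcard.ge)
  have hsub : simplexHull s ∩ simplexHull t ⊆ affineSpan ℝ ((s : Set (Euc d)) ∩ t) :=
    (K.inter_subset_convexHull hs ht).trans (convexHull_subset_affineSpan _)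
  refine measure_mono_null hsub (Measure.addHaar_affineSubspace _ _ fun htop => ?_)
  have h1 : a ∉ affineSpan ℝ ((s : Set (Euc d)) \ {a}) := by
    have h2 := (K.indep hs).notMem_affineSpan_sdiff ⟨a, has⟩ Set.univ
    have h3 : ((↑) : s → Euc d) '' (Set.univ \ {⟨a, has⟩}) = (s : Set (Euc d)) \ {a} := by
      ext y
      simp
      tauto
    rwa [h3] at h2
  refine h1 (affineSpan_mono ℝ (s₁ := (s : Set (Euc d)) ∩ t) ?_ (htop ▸ AffineSubspace.mem_top ℝ _ a))
  rintro y ⟨hys, hyt⟩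
  exact ⟨hys, fun hya => hat (by rwa [← Set.mem_singleton_iff.1 hya])⟩

/-- A packing bound: a ball of radius `R` contains at most `(R / r)^d` essentially disjoint sets
each of which contains a ball of radius `r`. -/
theorem card_le_of_packing {d : ℕ} {ι : Type*} (I : Finset ι) (T : ι → Set (Euc d))
    (hT : ∀ i ∈ I, MeasurableSet (T i))
    (hdisj : ∀ i ∈ I, ∀ j ∈ I, i ≠ j → volume (T i ∩ T j) = 0) {r R : ℝ} (hr : 0 < r) (hR : 0 ≤ R)
    (hball : ∀ i ∈ I, ∃ c, Metric.closedBall c r ⊆ T i) (y : Euc d)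
    (hsub : ∀ i ∈ I, T i ⊆ Metric.closedBall y R) : (I.card : ℝ) ≤ (R / r) ^ d := by
  set ω := volume (Metric.ball (0 : Euc d) 1) with hω
  have hω0 : 0 < ω := Metric.measure_ball_pos _ _ one_pos
  have hωt : ω ≠ ⊤ := measure_ball_lt_top.ne
  have hvol : ∀ (x : Euc d) {ρ : ℝ}, 0 ≤ ρ →
      volume (Metric.closedBall x ρ) = ENNReal.ofReal (ρ ^ d) * ω := fun x ρ hρ => by
    rw [Measure.addHaar_closedBall _ _ hρ, finrank_euclideanSpace_fin]
  have h1 : (I.card : ENNReal) * (ENNReal.ofReal (r ^ d) * ω) ≤ ENNReal.ofReal (R ^ d) * ω := by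
    calc (I.card : ENNReal) * (ENNReal.ofReal (r ^ d) * ω)
        = ∑ i ∈ I, ENNReal.ofReal (r ^ d) * ω := by rw [Finset.sum_const, nsmul_eq_mul]
      _ ≤ ∑ i ∈ I, volume (T i) := Finset.sum_le_sum fun i hi => by
          obtain ⟨c, hc⟩ := hball i hi
          rw [← hvol c hr.le]
          exact measure_mono hc
      _ = volume (⋃ i ∈ I, T i) := (measure_biUnion_finset₀
          (fun i hi j hj hij => hdisj i hi j hj hij) fun i hi => (hT i hi).nullMeasurableSet).symm
      _ ≤ volume (Metric.closedBall y R) := measure_mono (Set.iUnion₂_subset hsub)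
      _ = _ := hvol y hR
  rw [← mul_assoc, ENNReal.mul_le_mul_iff_left hω0.ne' hωt, ← ENNReal.ofReal_natCast,
    ← ENNReal.ofReal_mul (Nat.cast_nonneg _), ENNReal.ofReal_le_ofReal_iff (by positivity)] at h1
  rw [div_pow, le_div_iff₀ (by positivity)]
  exact h1

/-! ### Matrices of bilinear forms -/

section Forms

variable {ι ι' X : Type} [Fintype ι] [Fintype ι'] [MeasurableSpace X] {μ : Measure X}

theorem dotProduct_integral_mulVec (f : ι → ι' → X → ℝ) (hf : ∀ i j, Integrable (f i j) μ)
    (x : ι → ℝ) (y : ι' → ℝ) :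
    x ⬝ᵥ ((Matrix.of fun i j => ∫ t, f i j t ∂μ) *ᵥ y) = ∫ t, ∑ i, ∑ j, x i * (f i j t * y j) ∂μ := by
  have hint : ∀ i j, Integrable (fun t => x i * (f i j t * y j)) μ := fun i j =>
    ((hf i j).mul_const _).const_mul _
  rw [integral_finsetSum _ fun i _ => integrable_finsetSum _ fun j _ => hint i j]
  simp only [dotProduct, mulVec, Matrix.of_apply, Finset.mul_sum]
  refine Finset.sum_congr rfl fun i _ => ?_
  rw [integral_finsetSum _ fun j _ => hint i j]
  refine Finset.sum_congr rfl fun j _ => ?_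
  rw [integral_const_mul, integral_mul_const]

theorem dotProduct_mass_mulVec (f : ι → X → ℝ) (g : ι' → X → ℝ)
    (hf : ∀ i j, Integrable (fun t => f i t * g j t) μ) (x : ι → ℝ) (y : ι' → ℝ) :
    x ⬝ᵥ ((Matrix.of fun i j => ∫ t, f i t * g j t ∂μ) *ᵥ y) =
      ∫ t, (∑ i, x i * f i t) * ∑ j, y j * g j t ∂μ := by
  rw [dotProduct_integral_mulVec _ hf]
  congr 1
  ext t
  rw [Finset.sum_mul_sum]
  exact Finset.sum_congr rfl fun i _ => Finset.sum_congr rfl fun j _ => by ring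

theorem sqNorm_stiffness {E : Type*} [NormedAddCommGroup E] [InnerProductSpace ℝ E] (a : X → ℝ)
    (G : ι → X → E) (hG : ∀ i j, Integrable (fun t => a t * inner ℝ (G i t) (G j t)) μ)
    (x : ι → ℝ) :
    sqNorm (Matrix.of fun i j => ∫ t, a t * inner ℝ (G i t) (G j t) ∂μ) x =
      ∫ t, a t * ‖∑ i, x i • G i t‖ ^ 2 ∂μ := by
  rw [sqNorm, dotProduct_integral_mulVec _ hG]
  congr 1
  ext t
  simp only [← real_inner_self_eq_norm_sq, sum_inner, inner_sum, real_inner_smul_left,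
    real_inner_smul_right, Finset.mul_sum]
  exact Finset.sum_congr rfl fun i _ => Finset.sum_congr rfl fun j _ => by
    rw [real_inner_comm]; ring

end Forms

theorem integrableOn_of_isCompact {X : Type*} [TopologicalSpace X] [MeasurableSpace X]
    [OpensMeasurableSpace X] [T2Space X] {μ : Measure X} {K : Set X} {f : X → ℝ} (hK : IsCompact K)
    (hf : ContinuousOn f K) (hμ : μ K ≠ ⊤) : IntegrableOn f K μ := by
  obtain ⟨C, hC⟩ := hK.exists_bound_of_continuousOn hf
  refine ⟨hf.aestronglyMeasurable_of_isCompact hK hK.measurableSet, ?_⟩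
  refine HasFiniteIntegral.restrict_of_bounded (C := C) hμ.lt_top ?_
  filter_upwards [ae_restrict_mem hK.measurableSet] with y hy using hC y hy

/-! ### Gradients of piecewise polynomials -/

theorem gradient_eq_of_eqOn {d : ℕ} {v w : Euc d → ℝ} {S : Set (Euc d)} (h : Set.EqOn v w S)
    {x : Euc d} (hx : x ∈ interior S) : gradient v x = gradient w x := by
  have : v =ᶠ[nhds x] w := Filter.eventuallyEq_of_mem (mem_interior_iff_mem_nhds.1 hx) h
  rw [gradient, gradient, this.fderiv_eq]

theorem measurable_gradient {d : ℕ} (v : Euc d → ℝ) : Measurable (gradient v) :=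
  (LinearIsometryEquiv.continuous _).measurable.comp (measurable_fderiv ℝ v)

theorem MvPolynomial.continuous_gradient_eval {d : ℕ} (P : MvPolynomial (Fin d) ℝ) :
    Continuous (gradient fun x : Euc d => MvPolynomial.eval (fun i => x i) P) :=
  (LinearIsometryEquiv.continuous _).comp (P.contDiff_eval_euclidean.continuous_fderiv (by simp))

namespace BulkSurfaceFE

/-! ### Meshes -/

section Mesh

variable {d k : ℕ} (D : BulkSurfaceFE d k)

theorem finite_cells : D.cells.Finite := D.finite_bulkMesh.subset fun _ hs => hs.1

theorem closure_eq_iUnion_cells : closure D.Ω = ⋃ s ∈ D.cells, simplexHull s := by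
  rw [← D.space_bulkMesh]
  refine Set.Subset.antisymm (fun x hx => ?_) (Set.iUnion₂_subset fun s hs =>
    D.bulkMesh.convexHull_subset_space hs.1)
  obtain ⟨s, hs, hxs⟩ := D.bulkMesh.mem_space_iff.1 hx
  obtain ⟨t, ht, hst, hcard⟩ := D.pure_bulkMesh s hs
  exact Set.mem_biUnion (⟨ht, hcard⟩ : t ∈ D.cells) (convexHull_mono (by exact_mod_cast hst) hxs)

theorem subset_iUnion_cells : D.Ω ⊆ ⋃ s ∈ D.cells, simplexHull s :=
  D.closure_eq_iUnion_cells ▸ subset_closure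

theorem simplexHull_subset_closure {s : Finset (Euc d)} (hs : s ∈ D.bulkMesh.faces) :
    simplexHull s ⊆ closure D.Ω :=
  D.space_bulkMesh ▸ D.bulkMesh.convexHull_subset_space hs

theorem isCompact_closure : IsCompact (closure D.Ω) := by
  rw [closure_eq_iUnion_cells]
  exact D.finite_cells.isCompact_biUnion fun s _ => isCompact_simplexHull s

theorem isCompact_Γ : IsCompact D.Γ :=
  D.isCompact_closure.of_isClosed_subset isClosed_frontier frontier_subset_closure

theorem measurableSet_Γ : MeasurableSet D.Γ := D.isCompact_Γ.measurableSet

theorem Γ_eq_iUnion_surfFacets : D.Γ = ⋃ s ∈ D.surfFacets, simplexHull s := by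
  rw [Γ, ← D.space_surfMesh]
  refine Set.Subset.antisymm (fun x hx => ?_) (Set.iUnion₂_subset fun s hs => ?_)
  · obtain ⟨s, hs, hxs⟩ := D.surfMesh.mem_space_iff.1 hx
    obtain ⟨t, ht, hst, hcard⟩ := D.pure_surfMesh s hs
    refine Set.mem_biUnion (x := t) ?_ (convexHull_mono (by exact_mod_cast hst) hxs)
    simp [surfFacets, ht, hcard]
  · have hs' : s ∈ D.surfMesh.faces := by simpa using (Finset.mem_filter.1 hs).1
    exact D.surfMesh.convexHull_subset_space hs'

theorem simplexHull_subset_Γ {s : Finset (Euc d)} (hs : s ∈ D.surfFacets) :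
    simplexHull s ⊆ D.Γ := by
  rw [Γ_eq_iUnion_surfFacets]
  exact Set.subset_biUnion_of_mem (u := fun s : Finset (Euc d) => simplexHull s) hs

theorem mem_surfFacets {s : Finset (Euc d)} :
    s ∈ D.surfFacets ↔ s ∈ D.surfMesh.faces ∧ s.card = d := by
  simp [surfFacets]

theorem diam_le_h {s : Finset (Euc d)} (hs : s ∈ D.cells) : Metric.diam (simplexHull s) ≤ D.h :=
  le_csSup (D.finite_cells.image _).bddAbove (Set.mem_image_of_mem _ hs)

theorem dist_le_h {s : Finset (Euc d)} (hs : s ∈ D.bulkMesh.faces) {x y : Euc d}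
    (hx : x ∈ simplexHull s) (hy : y ∈ simplexHull s) : dist x y ≤ D.h := by
  obtain ⟨t, ht, hst, hcard⟩ := D.pure_bulkMesh s hs
  have hsub : simplexHull s ⊆ simplexHull t := convexHull_mono (by exact_mod_cast hst)
  exact (Metric.dist_le_diam_of_mem (isCompact_simplexHull t).isBounded (hsub hx) (hsub hy)).trans
    (D.diam_le_h ⟨ht, hcard⟩)

theorem h_pos (hd : d ≠ 0) {s : Finset (Euc d)} (hs : s ∈ D.cells) : 0 < D.h := by
  obtain ⟨a, ha, b, hb, hab⟩ := Finset.one_lt_card.1 (show 1 < s.card by rw [hs.2]; omega)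
  exact (dist_pos.2 hab).trans_le (D.dist_le_h hs.1 (subset_convexHull ℝ _ ha)
    (subset_convexHull ℝ _ hb))

theorem h_nonneg : 0 ≤ D.h :=
  Real.sSup_nonneg (by rintro _ ⟨s, -, rfl⟩; exact Metric.diam_nonneg)

/-- Frontiers of convex sets are null sets. Only in the interior of a cell is `gradient` known to be
that of the local polynomial, so all statements on gradients are made there. -/
theorem ae_mem_interior : ∀ᵐ x ∂(volume.restrict D.Ω), ∃ s ∈ D.cells,
    x ∈ interior (simplexHull s) := by
  have h1 : ∀ᵐ x ∂(volume : Measure (Euc d)), ∀ s ∈ D.cells, x ∉ frontier (simplexHull s) := by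
    rw [ae_ball_iff D.finite_cells.countable]
    exact fun s _ => measure_eq_zero_iff_ae_notMem.1 ((convex_simplexHull s).addHaar_frontier _)
  filter_upwards [ae_restrict_of_ae h1, ae_restrict_mem D.isOpen_Ω.measurableSet] with x hx hxΩ
  obtain ⟨s, hs, hxs⟩ := Set.mem_iUnion₂.1 (D.subset_iUnion_cells hxΩ)
  refine ⟨s, hs, ?_⟩
  by_contra hni
  exact hx s hs ⟨subset_closure hxs, hni⟩

/-! ### Finite element functions -/

/-- The function in `V_h` with a given coefficient vector. -/
def bulkFun (u : Fin D.NI ⊕ Fin D.NB → ℝ) (x : Euc d) : ℝ := ∑ i, u i * D.φ i x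

/-- The function in `Q_h` with a given coefficient vector. -/
def surfFun (p : Fin D.Np → ℝ) (x : Euc d) : ℝ := ∑ j, p j * D.q j x

theorem isPolyOn_bulkFun (u : Fin D.NI ⊕ Fin D.NB → ℝ) {s : Finset (Euc d)}
    (hs : s ∈ D.bulkMesh.faces) : IsPolyOn k (D.bulkFun u) (simplexHull s) :=
  IsPolyOn.sum_mul _ u D.φ fun i => (D.φ_mem i).2 s hs

theorem isPolyOn_surfFun (p : Fin D.Np → ℝ) {s : Finset (Euc d)} (hs : s ∈ D.surfFacets) :
    IsPolyOn D.ℓ (D.surfFun p) (simplexHull s) :=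
  IsPolyOn.sum_mul _ p D.q fun i => (D.q_mem i).2 s (D.mem_surfFacets.1 hs).1

theorem continuousOn_φ (i : Fin D.NI ⊕ Fin D.NB) : ContinuousOn (D.φ i) (closure D.Ω) :=
  D.space_bulkMesh ▸ (D.φ_mem i).1

theorem continuousOn_q (j : Fin D.Np) : ContinuousOn (D.q j) D.Γ := by
  have := (D.q_mem j).1
  rwa [D.space_surfMesh] at this

theorem continuousOn_bulkFun (u : Fin D.NI ⊕ Fin D.NB → ℝ) :
    ContinuousOn (D.bulkFun u) (closure D.Ω) :=
  continuousOn_finsetSum _ fun i _ => continuousOn_const.mul (D.continuousOn_φ i)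

theorem continuousOn_surfFun (p : Fin D.Np → ℝ) : ContinuousOn (D.surfFun p) D.Γ :=
  continuousOn_finsetSum _ fun i _ => continuousOn_const.mul (D.continuousOn_q i)

theorem bulkFun_node (u : Fin D.NI ⊕ Fin D.NB → ℝ) (i : Fin D.NI ⊕ Fin D.NB) :
    D.bulkFun u (D.node i) = u i := by
  simp [bulkFun, D.φ_node]

theorem lagrangeNodes_subset (hk : 1 ≤ k) {s : Finset (Euc d)} {m : Euc d → ℕ}
    (hm : ∑ a ∈ s, m a = k) : ∑ a ∈ s, ((m a : ℝ) / (k : ℝ)) • a ∈ simplexHull s := by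
  have hk0 : (k : ℝ) ≠ 0 := by positivity
  refine (convex_convexHull ℝ _).sum_mem (fun a _ => by positivity) ?_
    fun a ha => subset_convexHull ℝ _ ha
  rw [← Finset.sum_div, ← Nat.cast_sum, hm, div_self hk0]

theorem node_mem_closure (hk : 1 ≤ k) (i : Fin D.NI ⊕ Fin D.NB) : D.node i ∈ closure D.Ω := by
  have h : D.node i ∈ lagrangeNodes D.bulkMesh k := by
    rcases i with i | i
    · exact (D.range_node_inl ▸ Set.mem_range_self i :
        D.node (Sum.inl i) ∈ lagrangeNodes D.bulkMesh k \ frontier D.Ω).1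
    · exact (D.range_node_inr ▸ Set.mem_range_self i :
        D.node (Sum.inr i) ∈ lagrangeNodes D.bulkMesh k ∩ frontier D.Ω).1
  obtain ⟨s, hs, m, hm, hx⟩ := h
  rw [hx]
  exact D.simplexHull_subset_closure hs (lagrangeNodes_subset hk hm)

theorem node_inr_mem_Γ (i : Fin D.NB) : D.node (Sum.inr i) ∈ D.Γ :=
  (D.range_node_inr ▸ Set.mem_range_self i :
    D.node (Sum.inr i) ∈ lagrangeNodes D.bulkMesh k ∩ frontier D.Ω).2

theorem integrableOn_φ_mul (i j : Fin D.NI ⊕ Fin D.NB) :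
    IntegrableOn (fun x => D.φ i x * D.φ j x) D.Ω :=
  (integrableOn_of_isCompact D.isCompact_closure ((D.continuousOn_φ i).mul (D.continuousOn_φ j))
    D.isCompact_closure.measure_lt_top.ne).mono_set subset_closure

theorem dotProduct_Mu (x y : Fin D.NI ⊕ Fin D.NB → ℝ) :
    x ⬝ᵥ (D.Mu *ᵥ y) = ∫ t in D.Ω, D.bulkFun x t * D.bulkFun y t :=
  dotProduct_mass_mulVec _ _ D.integrableOn_φ_mul x y

theorem sqNorm_Mu (x : Fin D.NI ⊕ Fin D.NB → ℝ) :
    sqNorm D.Mu x = ∫ t in D.Ω, D.bulkFun x t ^ 2 := by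
  rw [sqNorm, dotProduct_Mu]
  simp only [pow_two]

/-- A continuous function vanishing almost everywhere on the open set vanishes on its closure, which
contains all nodes. This makes `D.Mu` invertible, as the dual norm of the data requires. -/
theorem eq_zero_of_sqNorm_Mu (hk : 1 ≤ k) {x : Fin D.NI ⊕ Fin D.NB → ℝ} (hx : sqNorm D.Mu x = 0) :
    x = 0 := by
  rw [sqNorm_Mu] at hx
  have hcont := D.continuousOn_bulkFun x
  have hint : IntegrableOn (fun t => D.bulkFun x t ^ 2) D.Ω :=
    (integrableOn_of_isCompact D.isCompact_closure (hcont.pow 2)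
      D.isCompact_closure.measure_lt_top.ne).mono_set subset_closure
  have h1 := (setIntegral_eq_zero_iff_of_nonneg_ae
    (Filter.Eventually.of_forall fun t => sq_nonneg (D.bulkFun x t)) hint).1 hx
  have h2 : Set.EqOn (fun t => D.bulkFun x t ^ 2) 0 D.Ω :=
    Measure.eqOn_open_of_ae_eq h1 D.isOpen_Ω ((hcont.mono subset_closure).pow 2) continuousOn_const
  have h3 : Set.EqOn (fun t => D.bulkFun x t ^ 2) (fun _ => 0) (closure D.Ω) :=
    h2.of_subset_closure (hcont.pow 2) continuousOn_const subset_closure subset_rfl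
  ext i
  have := h3 (D.node_mem_closure hk i)
  simpa [bulkFun_node] using this

/-! ### The bulk stiffness matrix -/

theorem gradient_bulkFun_eq (u : Fin D.NI ⊕ Fin D.NB → ℝ) {s : Finset (Euc d)} (hs : s ∈ D.cells)
    {x : Euc d} (hx : x ∈ interior (simplexHull s)) :
    gradient (D.bulkFun u) x = ∑ i, u i • gradient (D.φ i) x := by
  have hdiff : ∀ i, DifferentiableAt ℝ (D.φ i) x := fun i => by
    obtain ⟨P, -, hP⟩ := (D.φ_mem i).2 s hs.1
    have h1 : D.φ i =ᶠ[nhds x] fun x => MvPolynomial.eval (fun i => x i) P :=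
      Filter.eventuallyEq_of_mem (mem_interior_iff_mem_nhds.1 hx) hP
    exact (P.contDiff_eval_euclidean.differentiable (by simp) x).congr_of_eventuallyEq h1
  have h2 : fderiv ℝ (D.bulkFun u) x = ∑ i, u i • fderiv ℝ (D.φ i) x := by
    unfold bulkFun
    rw [fderiv_fun_sum fun i _ => (hdiff i).const_mul _]
    exact Finset.sum_congr rfl fun i _ => fderiv_const_mul (hdiff i) _
  rw [gradient, h2, map_sum]
  exact Finset.sum_congr rfl fun i _ => by rw [map_smulₛₗ]; rfl

theorem exists_gradient_φ_bound (i : Fin D.NI ⊕ Fin D.NB) :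
    ∃ B, ∀ᵐ x ∂(volume.restrict D.Ω), ‖gradient (D.φ i) x‖ ≤ B := by
  have h1 : ∀ s ∈ D.cells, ∃ B, ∀ x ∈ interior (simplexHull s), ‖gradient (D.φ i) x‖ ≤ B := by
    intro s hs
    obtain ⟨P, -, hP⟩ := (D.φ_mem i).2 s hs.1
    obtain ⟨B, hB⟩ := (isCompact_simplexHull s).exists_bound_of_continuousOn
      P.continuous_gradient_eval.continuousOn
    exact ⟨B, fun x hx => by rw [gradient_eq_of_eqOn hP hx]; exact hB x (interior_subset hx)⟩
  choose! B hB using h1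
  obtain ⟨M, hM⟩ := (D.finite_cells.image B).bddAbove
  refine ⟨M, ?_⟩
  filter_upwards [D.ae_mem_interior] with x ⟨s, hs, hxs⟩
  exact (hB s hs x hxs).trans (hM (Set.mem_image_of_mem B hs))

theorem integrableOn_stiffness (i j : Fin D.NI ⊕ Fin D.NB) :
    IntegrableOn (fun x => D.α x * inner ℝ (gradient (D.φ i) x) (gradient (D.φ j) x)) D.Ω := by
  obtain ⟨a₀, ha₀, a₁, ha⟩ := D.bounds_α
  obtain ⟨B, hB⟩ := D.exists_gradient_φ_bound i
  obtain ⟨B', hB'⟩ := D.exists_gradient_φ_bound j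
  refine ⟨D.aesm_α.mul ((measurable_gradient _).inner
    (measurable_gradient _)).aestronglyMeasurable, ?_⟩
  refine HasFiniteIntegral.restrict_of_bounded (C := a₁ * (B * B'))
    ((measure_mono subset_closure).trans_lt D.isCompact_closure.measure_lt_top) ?_
  filter_upwards [ha, hB, hB'] with x hx h1 h2
  rw [norm_mul, Real.norm_eq_abs, abs_of_nonneg (ha₀.le.trans hx.1)]
  have h3 := (norm_inner_le_norm (𝕜 := ℝ) (gradient (D.φ i) x) (gradient (D.φ j) x)).trans
    (mul_le_mul h1 h2 (norm_nonneg _) ((norm_nonneg _).trans h1))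
  exact mul_le_mul hx.2 h3 (norm_nonneg _) ((ha₀.le.trans hx.1).trans hx.2)

theorem sqNorm_Ku (x : Fin D.NI ⊕ Fin D.NB → ℝ) :
    sqNorm D.Ku x = ∫ t in D.Ω, D.α t * ‖gradient (D.bulkFun x) t‖ ^ 2 := by
  rw [Ku, sqNorm_stiffness _ _ D.integrableOn_stiffness]
  refine integral_congr_ae ?_
  filter_upwards [D.ae_mem_interior] with t ⟨s, hs, hts⟩
  rw [D.gradient_bulkFun_eq x hs hts]

theorem sqNorm_Ku_nonneg (x : Fin D.NI ⊕ Fin D.NB → ℝ) : 0 ≤ sqNorm D.Ku x := by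
  obtain ⟨a₀, ha₀, a₁, ha⟩ := D.bounds_α
  rw [sqNorm_Ku]
  refine integral_nonneg_of_ae ?_
  filter_upwards [ha] with t ht
  exact mul_nonneg (ha₀.le.trans ht.1) (sq_nonneg _)

end Mesh

end BulkSurfaceFE

namespace BulkSurfaceFE

/-! ### The boundary -/

section Boundary

variable {n k : ℕ} (D : BulkSurfaceFE (n + 1) k)

theorem surf_eq : D.surf = μHE[n].restrict D.Γ := rfl

/-- The facets of the triangulation of the bulk that are contained in the boundary. -/
def bdryFacets : Set (Finset (Euc (n + 1))) :=
  {s | s ∈ D.bulkMesh.faces ∧ s.card = n + 1 ∧ simplexHull s ⊆ D.Γ}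

theorem exists_bdryFacet {x : Euc (n + 1)} (hx : x ∈ D.Γ) :
    ∃ s ∈ D.bdryFacets, x ∈ simplexHull s := by
  rw [Γ, D.boundary_bulkMesh] at hx
  obtain ⟨s, hs, hxs⟩ := Set.mem_iUnion₂.1 hx
  exact ⟨s, hs, hxs⟩

theorem measure_surfFacet {s : Finset (Euc (n + 1))} (hs : s ∈ D.surfFacets) :
    0 < μHE[n] (simplexHull s) ∧ μHE[n] (simplexHull s) < ⊤ :=
  measure_simplexHull_pos_and_lt_top (D.surfMesh.indep (D.mem_surfFacets.1 hs).1)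
    (D.mem_surfFacets.1 hs).2

theorem measure_bdryFacet {s : Finset (Euc (n + 1))} (hs : s ∈ D.bdryFacets) :
    0 < μHE[n] (simplexHull s) ∧ μHE[n] (simplexHull s) < ⊤ :=
  measure_simplexHull_pos_and_lt_top (D.bulkMesh.indep hs.1) hs.2.1

theorem measure_Γ_lt_top : μHE[n] D.Γ < ⊤ := by
  rw [Γ_eq_iUnion_surfFacets]
  exact (measure_biUnion_finset_le _ _).trans_lt
    (ENNReal.sum_lt_top.2 fun s hs => (D.measure_surfFacet hs).2)

theorem integrable_surf {f : Euc (n + 1) → ℝ} (hf : ContinuousOn f D.Γ) : Integrable f D.surf :=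
  integrableOn_of_isCompact D.isCompact_Γ hf D.measure_Γ_lt_top.ne

theorem Γ_subset_closure : D.Γ ⊆ closure D.Ω := frontier_subset_closure

theorem continuousOn_φ_Γ (i : Fin D.NI ⊕ Fin D.NB) : ContinuousOn (D.φ i) D.Γ :=
  (D.continuousOn_φ i).mono D.Γ_subset_closure

/-- The extension of a coefficient vector in `M_h` by zero. -/
def extend (w : Fin D.NB → ℝ) : Fin D.NI ⊕ Fin D.NB → ℝ := Sum.elim 0 w

theorem bulkFun_extend (w : Fin D.NB → ℝ) (x : Euc (n + 1)) :
    D.bulkFun (D.extend w) x = ∑ i, w i * D.φ (Sum.inr i) x := by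
  simp [bulkFun, extend]

theorem dotProduct_Mlam (x y : Fin D.NB → ℝ) :
    x ⬝ᵥ (D.Mlam *ᵥ y) = ∫ t, D.bulkFun (D.extend x) t * D.bulkFun (D.extend y) t ∂D.surf := by
  simp only [bulkFun_extend]
  exact dotProduct_mass_mulVec _ _ (fun _ _ => D.integrable_surf
    ((D.continuousOn_φ_Γ _).mul (D.continuousOn_φ_Γ _))) x y

theorem dotProduct_Mp (x y : Fin D.Np → ℝ) :
    x ⬝ᵥ (D.Mp *ᵥ y) = ∫ t, D.surfFun x t * D.surfFun y t ∂D.surf :=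
  dotProduct_mass_mulVec _ _ (fun _ _ => D.integrable_surf
    ((D.continuousOn_q _).mul (D.continuousOn_q _))) x y

theorem dotProduct_Bp (x : Fin D.NB → ℝ) (y : Fin D.Np → ℝ) :
    x ⬝ᵥ (D.Bp *ᵥ y) = ∫ t, D.bulkFun (D.extend x) t * D.surfFun y t ∂D.surf := by
  simp only [bulkFun_extend]
  exact dotProduct_mass_mulVec _ _ (fun _ _ => D.integrable_surf
    ((D.continuousOn_φ_Γ _).mul (D.continuousOn_q _))) x y

theorem sqNorm_Mlam (x : Fin D.NB → ℝ) :
    sqNorm D.Mlam x = ∫ t, D.bulkFun (D.extend x) t ^ 2 ∂D.surf := by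
  rw [sqNorm, dotProduct_Mlam]
  simp only [pow_two]

theorem sqNorm_Mp (x : Fin D.Np → ℝ) : sqNorm D.Mp x = ∫ t, D.surfFun x t ^ 2 ∂D.surf := by
  rw [sqNorm, dotProduct_Mp]
  simp only [pow_two]

/-- A Lagrange node of a boundary facet is one of the boundary nodes. -/
theorem exists_node_inr {s : Finset (Euc (n + 1))} (hs : s ∈ D.bulkMesh.faces)
    {m : Euc (n + 1) → ℕ} (hm : ∑ a ∈ s, m a = k)
    (hΓ : ∑ a ∈ s, ((m a : ℝ) / (k : ℝ)) • a ∈ D.Γ) :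
    ∃ i, D.node (Sum.inr i) = ∑ a ∈ s, ((m a : ℝ) / (k : ℝ)) • a := by
  have : ∑ a ∈ s, ((m a : ℝ) / (k : ℝ)) • a ∈ lagrangeNodes D.bulkMesh k ∩ frontier D.Ω :=
    ⟨⟨s, hs, m, hm, rfl⟩, hΓ⟩
  rwa [← D.range_node_inr] at this

theorem exists_node_inl {s : Finset (Euc (n + 1))} (hs : s ∈ D.bulkMesh.faces)
    {m : Euc (n + 1) → ℕ} (hm : ∑ a ∈ s, m a = k)
    (hΓ : ∑ a ∈ s, ((m a : ℝ) / (k : ℝ)) • a ∉ D.Γ) :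
    ∃ i, D.node (Sum.inl i) = ∑ a ∈ s, ((m a : ℝ) / (k : ℝ)) • a := by
  have : ∑ a ∈ s, ((m a : ℝ) / (k : ℝ)) • a ∈ lagrangeNodes D.bulkMesh k \ frontier D.Ω :=
    ⟨⟨s, hs, m, hm, rfl⟩, hΓ⟩
  rwa [← D.range_node_inl] at this

/-- All Lagrange nodes of a boundary facet are boundary nodes, so the nodal bound applies with `M =
0`. It follows that `D.Bu` has a zero interior block. -/
theorem φ_inl_eq_zero (hk : 1 ≤ k) (i : Fin D.NI) {x : Euc (n + 1)} (hx : x ∈ D.Γ) :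
    D.φ (Sum.inl i) x = 0 := by
  obtain ⟨s, hs, hxs⟩ := D.exists_bdryFacet hx
  obtain ⟨C, -, hC⟩ := exists_nodal_bound n k hk
  have := hC (n + 1) s hs.2.1 (D.φ (Sum.inl i)) ((D.φ_mem _).2 s hs.1) 0 le_rfl
    (fun m hm => by
      obtain ⟨j, hj⟩ := D.exists_node_inr hs.1 hm (hs.2.2 (lagrangeNodes_subset hk hm))
      rw [← hj, D.φ_node]
      simp) x hxs
  rwa [mul_zero, abs_nonpos_iff] at this

theorem Bu_mulVec (hk : 1 ≤ k) (u : Fin D.NI ⊕ Fin D.NB → ℝ) :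
    D.Bu *ᵥ u = D.Mlam *ᵥ (u ∘ Sum.inr) := by
  ext i
  have h0 : ∀ j, D.Bu i (Sum.inl j) = 0 := fun j => by
    simp only [Bu, Matrix.of_apply]
    refine integral_eq_zero_of_ae ?_
    rw [surf_eq]
    filter_upwards [ae_restrict_mem D.measurableSet_Γ] with x hx
    rw [D.φ_inl_eq_zero hk j hx, mul_zero, Pi.zero_apply]
  simp only [mulVec, dotProduct, Fintype.sum_sum_type, h0, zero_mul, Finset.sum_const_zero,
    zero_add]
  rfl

theorem setIntegral_le_integral_surf {f : Euc (n + 1) → ℝ} (hf : ContinuousOn f D.Γ)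
    {S : Set (Euc (n + 1))} (hS : S ⊆ D.Γ) :
    ∫ x in S, f x ^ 2 ∂μHE[n] ≤ ∫ x, f x ^ 2 ∂D.surf :=
  setIntegral_mono_set (D.integrable_surf (hf.pow 2))
    (Filter.Eventually.of_forall fun x => sq_nonneg (f x)) (LE.le.eventuallyLE hS)

theorem continuousOn_bulkFun_Γ (u : Fin D.NI ⊕ Fin D.NB → ℝ) : ContinuousOn (D.bulkFun u) D.Γ :=
  (D.continuousOn_bulkFun u).mono D.Γ_subset_closure

/-- Each boundary node lies on a facet of positive measure, where the inverse estimate bounds the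
nodal value by the vanishing $L^2$ norm. -/
theorem eq_zero_of_sqNorm_Mlam {w : Fin D.NB → ℝ} (hw : sqNorm D.Mlam w = 0) : w = 0 := by
  obtain ⟨C, hC, H⟩ := exists_inverse_bound n k
  ext i
  obtain ⟨s, hs, hxs⟩ := D.exists_bdryFacet (D.node_inr_mem_Γ i)
  have hμ := D.measure_bdryFacet hs
  have h1 := H (n + 1) s (D.bulkFun (D.extend w)) (D.isPolyOn_bulkFun _ hs.1) hμ.2.ne _ hxs
  have h2 := D.setIntegral_le_integral_surf (D.continuousOn_bulkFun_Γ (D.extend w)) hs.2.2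
  rw [← sqNorm_Mlam, hw] at h2
  have h3 : 0 < (μHE[n] (simplexHull s)).toReal := ENNReal.toReal_pos hμ.1.ne' hμ.2.ne
  have h4 : D.bulkFun (D.extend w) (D.node (Sum.inr i)) ^ 2 ≤ 0 := by
    by_contra! h
    have := mul_pos h h3
    nlinarith
  rw [bulkFun_node] at h4
  simpa [extend] using pow_eq_zero_iff two_ne_zero |>.1 (le_antisymm h4 (sq_nonneg _))

theorem eq_zero_of_sqNorm_Mp {p : Fin D.Np → ℝ} (hp : sqNorm D.Mp p = 0) : p = 0 := by
  obtain ⟨C, hC, H⟩ := exists_inverse_bound n D.ℓ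
  have h0 : ∀ x ∈ D.Γ, D.surfFun p x = 0 := by
    intro x hx
    have hx' := hx
    rw [Γ_eq_iUnion_surfFacets] at hx'
    obtain ⟨s, hs, hxs⟩ := Set.mem_iUnion₂.1 hx'
    have hμ := D.measure_surfFacet hs
    have h1 := H (n + 1) s (D.surfFun p) (D.isPolyOn_surfFun _ hs) hμ.2.ne _ hxs
    have h2 := D.setIntegral_le_integral_surf (D.continuousOn_surfFun p)
      (D.simplexHull_subset_Γ hs)
    rw [← sqNorm_Mp, hp] at h2
    have h3 : 0 < (μHE[n] (simplexHull s)).toReal := ENNReal.toReal_pos hμ.1.ne' hμ.2.ne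
    have h4 : D.surfFun p x ^ 2 ≤ 0 := by
      by_contra! h
      have := mul_pos h h3
      nlinarith
    exact pow_eq_zero_iff two_ne_zero |>.1 (le_antisymm h4 (sq_nonneg _))
  ext j
  refine Fintype.linearIndependent_iff.1 D.q_indep p ?_ j
  ext x
  simpa [surfFun, Finset.sum_apply] using h0 x x.2

/-- The trace matching condition defines a projection in `L²(Γ)`. -/
theorem sqNorm_Mlam_le {w : Fin D.NB → ℝ} {p : Fin D.Np → ℝ} (h : D.Mlam *ᵥ w = D.Bp *ᵥ p) :
    sqNorm D.Mlam w ≤ sqNorm D.Mp p := by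
  have hv := D.continuousOn_bulkFun_Γ (D.extend w)
  have hq := D.continuousOn_surfFun p
  -- Testing the matching condition with `w` itself makes the error of the projection orthogonal to
  -- the projection.
  have h1 : sqNorm D.Mlam w = ∫ t, D.bulkFun (D.extend w) t * D.surfFun p t ∂D.surf := by
    rw [sqNorm, h, dotProduct_Bp]
  have h2 : 0 ≤ ∫ t, (D.bulkFun (D.extend w) t - D.surfFun p t) ^ 2 ∂D.surf :=
    integral_nonneg fun t => sq_nonneg _
  have h3 : ∫ t, (D.bulkFun (D.extend w) t - D.surfFun p t) ^ 2 ∂D.surf =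
      sqNorm D.Mlam w - 2 * ∫ t, D.bulkFun (D.extend w) t * D.surfFun p t ∂D.surf
        + sqNorm D.Mp p := by
    rw [sqNorm_Mlam, sqNorm_Mp, ← integral_const_mul, ← integral_sub, ← integral_add]
    · congr 1
      ext t
      ring
    · exact (D.integrable_surf (hv.pow 2)).sub ((D.integrable_surf (hv.mul hq)).const_mul 2)
    · exact D.integrable_surf (hq.pow 2)
    · exact D.integrable_surf (hv.pow 2)
    · exact (D.integrable_surf (hv.mul hq)).const_mul 2
  linarith

end Boundary

end BulkSurfaceFE

namespace BulkSurfaceFE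

/-! ### Inverse and trace inequalities for functions without interior degrees of freedom -/

section Estimates

variable {n k : ℕ} (D : BulkSurfaceFE (n + 1) k)

/-- The points whose neighbourhood of radius `2h` contains a given cell. -/
def near (s : Finset (Euc (n + 1))) : Set (Euc (n + 1)) :=
  {y | ∀ z ∈ simplexHull s, dist z y ≤ 2 * D.h}

theorem measurableSet_near (s : Finset (Euc (n + 1))) : MeasurableSet (D.near s) := by
  have : D.near s = ⋂ z ∈ simplexHull s, {y | dist z y ≤ 2 * D.h} := by
    ext y; simp [near]
  rw [this]
  exact (isClosed_biInter fun z _ =>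
    isClosed_le (by fun_prop) continuous_const).measurableSet

/-- The squared `L²` norm of the trace near a cell. -/
noncomputable def nearNorm (w : Fin D.NB → ℝ) (s : Finset (Euc (n + 1))) : ℝ :=
  ∫ y in D.near s, D.bulkFun (D.extend w) y ^ 2 ∂D.surf

theorem nearNorm_nonneg (w : Fin D.NB → ℝ) (s : Finset (Euc (n + 1))) : 0 ≤ D.nearNorm w s :=
  integral_nonneg fun _ => sq_nonneg _

theorem le_measure_bdryFacet {σ : ℝ} (hσ : 0 < σ) (hD : D.QuasiUniform σ)
    {F : Finset (Euc (n + 1))} (hF : F ∈ D.bdryFacets) :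
    (σ * D.h) ^ n * (volume (Metric.closedBall (0 : Euc n) 1)).toReal ≤
      (μHE[n] (simplexHull F)).toReal := by
  classical
  obtain ⟨t, ht, hFt, hcard⟩ := D.pure_bulkMesh F hF.1
  obtain ⟨a, hat, haF⟩ : ∃ a ∈ t, a ∉ F := by
    by_contra! h
    have := Finset.card_le_card (show t ⊆ F from h)
    have := hF.2.1
    omega
  have hins : insert a F = t := by
    refine Finset.eq_of_subset_of_card_le (Finset.insert_subset hat hFt) ?_
    rw [Finset.card_insert_of_notMem haF, hcard, hF.2.1]
  obtain ⟨c, hc⟩ := hD t ⟨ht, hcard⟩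
  have h1 := le_measure_facet (Finset.card_pos.1 (by rw [hF.2.1]; omega)) haF
    (c := c) (r := σ * D.h) (by rw [← Finset.coe_insert, hins]; exact hc)
  have hr : 0 ≤ σ * D.h := mul_nonneg hσ.le D.h_nonneg
  rw [Measure.addHaar_closedBall' _ _ hr, finrank_euclideanSpace_fin] at h1
  have h2 := ENNReal.toReal_mono (D.measure_bdryFacet hF).2.ne h1
  rwa [ENNReal.toReal_mul, ENNReal.toReal_ofReal (by positivity)] at h2

/-- Only nodes on the boundary contribute to the function on a cell. Each of them lies on a boundary
facet, of measure at least a constant times `D.h ^ n`, and the inverse estimate on this facet bounds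
the nodal value. The facet need not belong to the cell, which may touch the boundary only in a
vertex or an edge; hence the use of `near`. -/
theorem exists_local_bound (n k : ℕ) (hk : 1 ≤ k) {σ : ℝ} (hσ : 0 < σ) :
    ∃ C > 0, ∀ D : BulkSurfaceFE (n + 1) k, D.QuasiUniform σ → ∀ (w : Fin D.NB → ℝ),
      ∀ s ∈ D.cells, ∀ x ∈ simplexHull s,
        D.bulkFun (D.extend w) x ^ 2 ≤ C * D.nearNorm w s / D.h ^ n := by
  obtain ⟨CA, hCA, HA⟩ := exists_nodal_bound (n + 1) k hk
  obtain ⟨CB, hCB, HB⟩ := exists_inverse_bound n k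
  set ω := (volume (Metric.closedBall (0 : Euc n) 1)).toReal with hω
  have hω0 : 0 < ω := ENNReal.toReal_pos
    (Metric.measure_closedBall_pos _ _ one_pos).ne' measure_closedBall_lt_top.ne
  refine ⟨CA ^ 2 * (CB / (σ ^ n * ω)), by positivity, fun D hD w s hs x hx => ?_⟩
  have hh := D.h_pos n.succ_ne_zero hs
  set v := D.bulkFun (D.extend w) with hv
  set J := D.nearNorm w s with hJ
  have hJ0 : 0 ≤ J := D.nearNorm_nonneg w s
  set M2 := CB * J / (σ ^ n * ω * D.h ^ n) with hM2
  have hM20 : 0 ≤ M2 := by positivity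
  have hnode : ∀ y ∈ simplexHull s, y ∈ D.Γ → v y ^ 2 ≤ M2 := by
    intro y hys hy
    obtain ⟨F, hF, hyF⟩ := D.exists_bdryFacet hy
    have h1 := HB (n + 1) F v (D.isPolyOn_bulkFun _ hF.1) (D.measure_bdryFacet hF).2.ne y hyF
    have h2 := D.le_measure_bdryFacet hσ hD hF
    -- Cell and facet share the point `y` and each has diameter at most `D.h`, which explains the
    -- radius `2h` in `near`.
    have hsub : simplexHull F ⊆ D.near s ∩ D.Γ := fun z hz => ⟨fun y' hy' => by
      have h3 := D.dist_le_h hs.1 hy' hys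
      have h4 := D.dist_le_h hF.1 hyF hz
      linarith [dist_triangle y' y z], hF.2.2 hz⟩
    have h3 : ∫ z in simplexHull F, v z ^ 2 ∂μHE[n] ≤ J := by
      rw [hJ, nearNorm, surf_eq, Measure.restrict_restrict (D.measurableSet_near s)]
      refine setIntegral_mono_set ?_ (Filter.Eventually.of_forall fun z => sq_nonneg (v z))
        (LE.le.eventuallyLE hsub)
      have h4 : IntegrableOn (fun z => v z ^ 2) D.Γ μHE[n] :=
        D.integrable_surf ((D.continuousOn_bulkFun_Γ _).pow 2)
      exact h4.mono_set Set.inter_subset_right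
    rw [hM2, le_div_iff₀ (by positivity)]
    calc v y ^ 2 * (σ ^ n * ω * D.h ^ n) = v y ^ 2 * ((σ * D.h) ^ n * ω) := by ring
      _ ≤ v y ^ 2 * (μHE[n] (simplexHull F)).toReal := by gcongr
      _ ≤ CB * ∫ z in simplexHull F, v z ^ 2 ∂μHE[n] := h1
      _ ≤ CB * J := by gcongr
  have h1 := HA (n + 1) s hs.2 v (D.isPolyOn_bulkFun _ hs.1) (Real.sqrt M2) (Real.sqrt_nonneg _)
    (fun m hm => by
      have hmem := lagrangeNodes_subset hk hm
      by_cases hΓ : ∑ a ∈ s, ((m a : ℝ) / (k : ℝ)) • a ∈ D.Γ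
      · exact Real.abs_le_sqrt (hnode _ hmem hΓ)
      · obtain ⟨i, hi⟩ := D.exists_node_inl hs.1 hm hΓ
        rw [← hi, hv, bulkFun_node]
        simp [extend]) x hx
  calc v x ^ 2 = |v x| ^ 2 := (sq_abs _).symm
    _ ≤ (CA * Real.sqrt M2) ^ 2 := by gcongr
    _ = CA ^ 2 * M2 := by rw [mul_pow, Real.sq_sqrt hM20]
    _ = _ := by rw [hM2]; field_simp

/-- Exchanging sum and integral leaves, at each `y`, the number of cells with `y ∈ D.near s`. These
cells lie in a ball of radius `2h` and contain balls of radius `σ h`, so the packing bound applies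
and the mesh width cancels. -/
theorem sum_nearNorm_le {σ : ℝ} (hσ : 0 < σ) (hD : D.QuasiUniform σ) (w : Fin D.NB → ℝ) :
    ∑ s ∈ D.finite_cells.toFinset, D.nearNorm w s ≤ (2 / σ) ^ (n + 1) * sqNorm D.Mlam w := by
  classical
  set v := D.bulkFun (D.extend w) with hv
  have hint : Integrable (fun y => v y ^ 2) D.surf :=
    D.integrable_surf ((D.continuousOn_bulkFun_Γ _).pow 2)
  have hcount : ∀ y, ((D.finite_cells.toFinset.filter fun s => y ∈ D.near s).card : ℝ) ≤
      (2 / σ) ^ (n + 1) := by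
    intro y
    set I := D.finite_cells.toFinset.filter fun s => y ∈ D.near s with hI
    have hIc : ∀ s ∈ I, s ∈ D.cells := fun s hs => by simpa using (Finset.mem_filter.1 hs).1
    rcases I.eq_empty_or_nonempty with h0 | ⟨s, hs⟩
    · rw [h0]; simp; positivity
    have hh := D.h_pos n.succ_ne_zero (hIc s hs)
    have h1 := card_le_of_packing I simplexHull
      (fun i _ => (isCompact_simplexHull i).measurableSet)
      (fun i hi j hj hij => D.bulkMesh.volume_inter_eq_zero (hIc i hi).1 (hIc j hj).1
        ((hIc i hi).2.trans (hIc j hj).2.symm) hij)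
      (r := σ * D.h) (R := 2 * D.h) (by positivity) (by positivity)
      (fun i hi => hD i (hIc i hi)) y fun i hi z hz => (Finset.mem_filter.1 hi).2 z hz
    rwa [mul_div_mul_right _ _ hh.ne'] at h1
  have h1 : ∑ s ∈ D.finite_cells.toFinset, D.nearNorm w s =
      ∫ y, ((D.finite_cells.toFinset.filter fun s => y ∈ D.near s).card : ℝ) * v y ^ 2 ∂D.surf := by
    simp only [nearNorm, ← integral_indicator (D.measurableSet_near _)]
    rw [← integral_finsetSum _ fun s _ => hint.indicator (D.measurableSet_near s)]
    congr 1
    ext y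
    rw [Finset.card_filter]
    push_cast
    rw [Finset.sum_mul]
    refine Finset.sum_congr rfl fun s _ => ?_
    by_cases hy : y ∈ D.near s <;> simp [hy, hv]
  rw [h1, sqNorm_Mlam, ← integral_const_mul]
  refine integral_mono_of_nonneg (Filter.Eventually.of_forall fun y => by positivity)
    (hint.const_mul _) (Filter.Eventually.of_forall fun y => ?_)
  exact mul_le_mul_of_nonneg_right (hcount y) (sq_nonneg _)

theorem volume_cell_le {s : Finset (Euc (n + 1))} (hs : s ∈ D.cells) :
    (volume (simplexHull s)).toReal ≤
      D.h ^ (n + 1) * (volume (Metric.closedBall (0 : Euc (n + 1)) 1)).toReal := by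
  obtain ⟨a, ha⟩ : s.Nonempty := Finset.card_pos.1 (by rw [hs.2]; omega)
  have hsub : simplexHull s ⊆ Metric.closedBall a D.h := fun x hx =>
    D.dist_le_h hs.1 hx (subset_convexHull ℝ _ ha)
  have h2 := ENNReal.toReal_mono measure_closedBall_lt_top.ne (measure_mono (μ := volume) hsub)
  rwa [Measure.addHaar_closedBall' _ _ D.h_nonneg, finrank_euclideanSpace_fin, ENNReal.toReal_mul,
    ENNReal.toReal_ofReal (pow_nonneg D.h_nonneg _)] at h2

theorem integral_le_of_cellwise {g : Euc (n + 1) → ℝ} {c : Finset (Euc (n + 1)) → ℝ}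
    (hc : ∀ s, 0 ≤ c s) (hg0 : 0 ≤ᵐ[volume.restrict D.Ω] g)
    (hg : ∀ᵐ x ∂(volume.restrict D.Ω), ∀ s ∈ D.cells, x ∈ interior (simplexHull s) → g x ≤ c s) :
    ∫ x in D.Ω, g x ≤ (D.h ^ (n + 1) * (volume (Metric.closedBall (0 : Euc (n + 1)) 1)).toReal) *
      ∑ s ∈ D.finite_cells.toFinset, c s := by
  have hm : ∀ s : Finset (Euc (n + 1)), MeasurableSet (simplexHull s) := fun s =>
    (isCompact_simplexHull s).measurableSet
  have hint : ∀ s : Finset (Euc (n + 1)),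
      Integrable ((simplexHull s).indicator fun _ => c s) volume := fun s =>
    (integrable_indicator_iff (hm s)).2
      (integrableOn_const (isCompact_simplexHull s).measure_lt_top.ne)
  have hnn : ∀ x (s : Finset (Euc (n + 1))), 0 ≤ (simplexHull s).indicator (fun _ => c s) x :=
    fun x s => Set.indicator_nonneg (fun _ _ => hc s) x
  have hint' : Integrable (fun x => ∑ s ∈ D.finite_cells.toFinset,
      (simplexHull s).indicator (fun _ => c s) x) volume := integrable_finsetSum _ fun s _ => hint s
  calc ∫ x in D.Ω, g x
      ≤ ∫ x in D.Ω, ∑ s ∈ D.finite_cells.toFinset, (simplexHull s).indicator (fun _ => c s) x := by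
        refine integral_mono_of_nonneg hg0 hint'.integrableOn ?_
        filter_upwards [hg, D.ae_mem_interior] with x hx ⟨s, hs, hxs⟩
        refine (hx s hs hxs).trans ?_
        have h1 := Finset.single_le_sum (f := fun s : Finset (Euc (n + 1)) =>
          (simplexHull s).indicator (fun _ => c s) x) (fun s _ => hnn x s)
          (D.finite_cells.mem_toFinset.2 hs)
        simpa only [Set.indicator_of_mem (interior_subset hxs)] using h1
    _ ≤ ∫ x, ∑ s ∈ D.finite_cells.toFinset, (simplexHull s).indicator (fun _ => c s) x :=
        setIntegral_le_integral hint'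
          (Filter.Eventually.of_forall fun x => Finset.sum_nonneg fun s _ => hnn x s)
    _ = ∑ s ∈ D.finite_cells.toFinset, (volume (simplexHull s)).toReal * c s := by
        rw [integral_finsetSum _ fun s _ => hint s]
        refine Finset.sum_congr rfl fun s _ => ?_
        rw [integral_indicator (hm s), setIntegral_const, smul_eq_mul, Measure.real]
    _ ≤ _ := by
        rw [Finset.mul_sum]
        exact Finset.sum_le_sum fun s hs => mul_le_mul_of_nonneg_right
          (D.volume_cell_le (D.finite_cells.mem_toFinset.1 hs)) (hc s)

/-- The volume of a cell is of order `D.h ^ (n + 1)`, while the pointwise bound divides by the facet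
scale `D.h ^ n`; one power of the mesh width remains. -/
theorem exists_mass_bound (n k : ℕ) (hk : 1 ≤ k) {σ : ℝ} (hσ : 0 < σ) :
    ∃ cM > 0, ∀ D : BulkSurfaceFE (n + 1) k, D.QuasiUniform σ → ∀ w : Fin D.NB → ℝ,
      sqNorm D.Mu (D.extend w) ≤ cM * D.h * sqNorm D.Mlam w := by
  obtain ⟨C, hC, H⟩ := exists_local_bound n k hk hσ
  set ω := (volume (Metric.closedBall (0 : Euc (n + 1)) 1)).toReal with hω
  have hω0 : 0 < ω := ENNReal.toReal_pos
    (Metric.measure_closedBall_pos _ _ one_pos).ne' measure_closedBall_lt_top.ne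
  refine ⟨ω * C * (2 / σ) ^ (n + 1), by positivity, fun D hD w => ?_⟩
  have hh := D.h_nonneg
  have h1 := D.integral_le_of_cellwise (g := fun x => D.bulkFun (D.extend w) x ^ 2)
    (c := fun s => C * D.nearNorm w s / D.h ^ n)
    (fun s => by have := D.nearNorm_nonneg w s; positivity)
    (Filter.Eventually.of_forall fun x => sq_nonneg _)
    (Filter.Eventually.of_forall fun x s hs hx => H D hD w s hs x (interior_subset hx))
  rw [← sqNorm_Mu] at h1
  refine h1.trans ?_
  have h2 := D.sum_nearNorm_le hσ hD w
  -- This is stated as an inequality so that `D.h = 0`, the value for a mesh without cells, needs no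
  -- separate treatment.
  have h3 : D.h ^ (n + 1) / D.h ^ n ≤ D.h := by
    rw [pow_succ, mul_comm, mul_div_assoc]
    exact mul_le_of_le_one_right hh (div_self_le_one _)
  have h0 : 0 ≤ ∑ s ∈ D.finite_cells.toFinset, D.nearNorm w s :=
    Finset.sum_nonneg fun s _ => D.nearNorm_nonneg w s
  calc D.h ^ (n + 1) * ω * ∑ s ∈ D.finite_cells.toFinset, C * D.nearNorm w s / D.h ^ n
      = ω * C * (D.h ^ (n + 1) / D.h ^ n) * ∑ s ∈ D.finite_cells.toFinset, D.nearNorm w s := by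
        rw [← Finset.sum_div, ← Finset.mul_sum]; ring
    _ ≤ ω * C * D.h * ((2 / σ) ^ (n + 1) * sqNorm D.Mlam w) := by gcongr
    _ = _ := by ring

/-- The gradient estimate on a cell containing a ball of radius `σ h` costs two further powers of
the mesh width compared with the mass bound. -/
theorem exists_stiffness_bound (n k : ℕ) (hk : 1 ≤ k) {σ : ℝ} (hσ : 0 < σ) {αmax : ℝ}
    (hα : 0 < αmax) : ∃ cK > 0, ∀ D : BulkSurfaceFE (n + 1) k, D.QuasiUniform σ →
      (∀ᵐ x ∂(volume.restrict D.Ω), D.α x ≤ αmax) → ∀ w : Fin D.NB → ℝ,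
      sqNorm D.Ku (D.extend w) ≤ cK * D.h⁻¹ * sqNorm D.Mlam w := by
  obtain ⟨C, hC, H⟩ := exists_local_bound n k hk hσ
  obtain ⟨CG, hCG, HG⟩ := exists_gradient_bound k
  set ω := (volume (Metric.closedBall (0 : Euc (n + 1)) 1)).toReal with hω
  have hω0 : 0 < ω := ENNReal.toReal_pos
    (Metric.measure_closedBall_pos _ _ one_pos).ne' measure_closedBall_lt_top.ne
  refine ⟨ω * (αmax * CG ^ 2 * C / σ ^ 2) * (2 / σ) ^ (n + 1), by positivity,
    fun D hD hDα w => ?_⟩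
  have hh := D.h_nonneg
  have hJ := D.nearNorm_nonneg w
  obtain ⟨a₀, ha₀, a₁, ha⟩ := D.bounds_α
  have hgrad : ∀ s ∈ D.cells, ∀ x ∈ interior (simplexHull s),
      ‖gradient (D.bulkFun (D.extend w)) x‖ ^ 2 ≤
        CG ^ 2 * (C * D.nearNorm w s / D.h ^ n) / (σ * D.h) ^ 2 := by
    intro s hs x hx
    have hh := D.h_pos n.succ_ne_zero hs
    obtain ⟨P, hP, hPv⟩ := D.isPolyOn_bulkFun (D.extend w) hs.1
    obtain ⟨c, hc⟩ := hD s hs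
    have h1 := HG (n + 1) (simplexHull s) (convex_simplexHull s) P hP
      (Real.sqrt (C * D.nearNorm w s / D.h ^ n))
      (fun y hy => by rw [← hPv y hy]; exact Real.abs_le_sqrt (H D hD w s hs y hy))
      c (σ * D.h) (by positivity) hc x (interior_subset hx)
    rw [gradient_eq_of_eqOn hPv hx]
    refine (pow_le_pow_left₀ (norm_nonneg _) h1 2).trans_eq ?_
    rw [div_pow, mul_pow, Real.sq_sqrt]
    have := hJ s
    positivity
  have h1 := D.integral_le_of_cellwise
    (g := fun x => D.α x * ‖gradient (D.bulkFun (D.extend w)) x‖ ^ 2)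
    (c := fun s => αmax * (CG ^ 2 * (C * D.nearNorm w s / D.h ^ n) / (σ * D.h) ^ 2))
    (fun s => by have := hJ s; positivity)
    (by filter_upwards [ha] with x hx using mul_nonneg (ha₀.le.trans hx.1) (sq_nonneg _))
    (by filter_upwards [hDα] with x hxα s hs hx using
          mul_le_mul hxα (hgrad s hs x hx) (sq_nonneg _) hα.le)
  rw [← sqNorm_Ku] at h1
  refine h1.trans ?_
  have h2 := D.sum_nearNorm_le hσ hD w
  have h3 : D.h ^ (n + 1) / (D.h ^ n * D.h ^ 2) ≤ D.h⁻¹ := by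
    rcases hh.eq_or_lt with h0 | h0
    · rw [← h0]; simp
    · refine le_of_eq ?_
      field_simp
      rw [pow_succ]
  have h0 : 0 ≤ ∑ s ∈ D.finite_cells.toFinset, D.nearNorm w s :=
    Finset.sum_nonneg fun s _ => hJ s
  calc D.h ^ (n + 1) * ω * ∑ s ∈ D.finite_cells.toFinset,
        αmax * (CG ^ 2 * (C * D.nearNorm w s / D.h ^ n) / (σ * D.h) ^ 2)
      = ω * (αmax * CG ^ 2 * C / σ ^ 2) * (D.h ^ (n + 1) / (D.h ^ n * D.h ^ 2)) *
          ∑ s ∈ D.finite_cells.toFinset, D.nearNorm w s := by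
        rw [Finset.mul_sum, Finset.mul_sum]
        refine Finset.sum_congr rfl fun s _ => ?_
        rw [mul_pow]
        simp only [div_eq_mul_inv, mul_inv]
        ring
    _ ≤ ω * (αmax * CG ^ 2 * C / σ ^ 2) * D.h⁻¹ * ((2 / σ) ^ (n + 1) * sqNorm D.Mlam w) := by
        have := inv_nonneg.2 hh
        gcongr
    _ = _ := by ring

theorem sqNorm_toBlocks₂₂ (A : Matrix (Fin D.NI ⊕ Fin D.NB) (Fin D.NI ⊕ Fin D.NB) ℝ)
    (w : Fin D.NB → ℝ) : sqNorm A.toBlocks₂₂ w = sqNorm A (D.extend w) := by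
  simp [sqNorm, dotProduct, mulVec, Fintype.sum_sum_type, extend, toBlocks₂₂]

end Estimates

end BulkSurfaceFE

/-! ### Quadratic forms -/

section Quadratic

variable {ι : Type} [Fintype ι] {A : Matrix ι ι ℝ}

theorem Matrix.IsSymm.dotProduct_mulVec_comm (hA : A.IsSymm) (x y : ι → ℝ) :
    x ⬝ᵥ (A *ᵥ y) = y ⬝ᵥ (A *ᵥ x) := by
  rw [dotProduct_mulVec, ← mulVec_transpose, hA.eq, dotProduct_comm]

theorem sqNorm_sub (hA : A.IsSymm) (x y : ι → ℝ) :
    sqNorm A (x - y) = sqNorm A x - 2 * (x ⬝ᵥ (A *ᵥ y)) + sqNorm A y := by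
  simp only [sqNorm, mulVec_sub, dotProduct_sub, sub_dotProduct]
  rw [hA.dotProduct_mulVec_comm y x]
  ring

theorem sqNorm_smul (c : ℝ) (x : ι → ℝ) : sqNorm A (c • x) = c ^ 2 * sqNorm A x := by
  simp only [sqNorm, mulVec_smul, dotProduct_smul, smul_dotProduct, smul_eq_mul]
  ring

theorem isUnit_det_of_sqNorm [DecidableEq ι] (hA : ∀ x, sqNorm A x = 0 → x = 0) :
    IsUnit A.det := by
  rw [← Matrix.isUnit_iff_isUnit_det, ← Matrix.mulVec_injective_iff_isUnit]
  refine (injective_iff_map_eq_zero (Matrix.mulVecLin A)).2 fun x hx => hA x ?_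
  rw [Matrix.mulVecLin_apply] at hx
  rw [sqNorm, hx, dotProduct_zero]

/-- Young's inequality for a quadratic form and its dual. -/
theorem two_mul_dotProduct_le [DecidableEq ι] (hA : A.IsSymm) (hA0 : ∀ x, 0 ≤ sqNorm A x)
    (hdet : IsUnit A.det) {τ : ℝ} (hτ : 0 < τ) (x f : ι → ℝ) :
    2 * (x ⬝ᵥ f) ≤ 2 * τ * sqNorm A⁻¹ f + 1 / (2 * τ) * sqNorm A x := by
  have hf : A *ᵥ (A⁻¹ *ᵥ f) = f := by rw [mulVec_mulVec, mul_nonsing_inv _ hdet, one_mulVec]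
  have h1 : sqNorm A (A⁻¹ *ᵥ f) = sqNorm A⁻¹ f := by
    rw [sqNorm, sqNorm, hf, dotProduct_comm]
  -- The weight `2 * τ` spends `1 / (2 * τ)` of the `2 / τ` that BDF-2 provides for each increment.
  have h2 := hA0 (x - (2 * τ) • (A⁻¹ *ᵥ f))
  rw [sqNorm_sub hA, sqNorm_smul, h1, mulVec_smul, hf, dotProduct_smul, smul_eq_mul] at h2
  have h3 : 0 ≤ (sqNorm A x - 2 * (2 * τ * (x ⬝ᵥ f)) + (2 * τ) ^ 2 * sqNorm A⁻¹ f) / (2 * τ) := by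
    positivity
  have h4 : (sqNorm A x - 2 * (2 * τ * (x ⬝ᵥ f)) + (2 * τ) ^ 2 * sqNorm A⁻¹ f) / (2 * τ) =
      2 * τ * sqNorm A⁻¹ f + 1 / (2 * τ) * sqNorm A x - 2 * (x ⬝ᵥ f) := by
    field_simp
    ring
  linarith

/-- In terms of increments the BDF-2 quotient is $\frac1{2\tau}(3Ex^n-Ex^{n-1})$. Polarization of
the mixed product yields a telescoping part and the squared second difference. -/
theorem dotProduct_bdf2 (hA : A.IsSymm) (τ : ℝ) (x : ℤ → ι → ℝ) (n : ℤ) :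
    2 * (bdiff x n ⬝ᵥ (A *ᵥ bdf2 τ x n)) = 2 / τ * sqNorm A (bdiff x n)
      + 1 / (2 * τ) * (sqNorm A (bdiff x n) - sqNorm A (bdiff x (n - 1))
        + sqNorm A (bdiff (bdiff x) n)) := by
  have h1 : bdf2 τ x n = (1 / (2 * τ)) • ((3 : ℝ) • bdiff x n - bdiff x (n - 1)) := by
    simp only [bdf2, bdiff, show n - 1 - 1 = n - 2 by ring]
    module
  have h2 := sqNorm_sub hA (bdiff x n) (bdiff x (n - 1))
  rw [h1, mulVec_smul, mulVec_sub, mulVec_smul, dotProduct_smul, dotProduct_sub, dotProduct_smul,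
    smul_eq_mul, smul_eq_mul, ← sqNorm,
    show bdiff (bdiff x) n = bdiff x n - bdiff x (n - 1) from rfl, h2]
  simp only [div_eq_mul_inv, mul_inv]
  ring

theorem two_mul_dotProduct_bdiff (hA : A.IsSymm) (x : ℤ → ι → ℝ) (n : ℤ) :
    2 * (bdiff x n ⬝ᵥ (A *ᵥ x n)) =
      sqNorm A (x n) - sqNorm A (x (n - 1)) + sqNorm A (bdiff x n) := by
  have h2 := sqNorm_sub hA (x n) (bdiff x n)
  rw [show x n - bdiff x n = x (n - 1) by simp [bdiff], hA.dotProduct_mulVec_comm] at h2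
  linarith

end Quadratic

theorem dotProduct_mulVec_toBlocks {ι κ : Type} [Fintype ι] [Fintype κ]
    (A : Matrix (ι ⊕ κ) (ι ⊕ κ) ℝ) (x y : ι ⊕ κ → ℝ) :
    x ⬝ᵥ (A *ᵥ y) =
      (x ∘ Sum.inl) ⬝ᵥ (A.toBlocks₁₁ *ᵥ (y ∘ Sum.inl) + A.toBlocks₁₂ *ᵥ (y ∘ Sum.inr)) +
      (x ∘ Sum.inr) ⬝ᵥ (A.toBlocks₂₁ *ᵥ (y ∘ Sum.inl) + A.toBlocks₂₂ *ᵥ (y ∘ Sum.inr)) := by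
  simp [dotProduct, mulVec, Fintype.sum_sum_type, toBlocks₁₁, toBlocks₁₂, toBlocks₂₁, toBlocks₂₂]

/-! ### The scheme tested with increments -/

namespace BulkSurfaceFE

section Energy

variable {n k : ℕ} (D : BulkSurfaceFE (n + 1) k)

theorem isSymm_Mu : D.Mu.IsSymm := by ext i j; simp [Mu, mul_comm]

theorem isSymm_Ku : D.Ku.IsSymm := by ext i j; simp only [transpose_apply, Ku, Matrix.of_apply, real_inner_comm]

theorem isSymm_Mp : D.Mp.IsSymm := by ext i j; simp [Mp, mul_comm]

theorem isSymm_Kp : D.Kp.IsSymm := by ext i j; simp [Kp, real_inner_comm]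

theorem isSymm_Mlam : D.Mlam.IsSymm := by ext i j; simp [Mlam, mul_comm]

theorem sqNorm_Mu_nonneg (x : Fin D.NI ⊕ Fin D.NB → ℝ) : 0 ≤ sqNorm D.Mu x := by
  rw [sqNorm_Mu]; exact integral_nonneg fun t => sq_nonneg _

theorem sqNorm_Mp_nonneg (x : Fin D.Np → ℝ) : 0 ≤ sqNorm D.Mp x := by
  rw [sqNorm_Mp]; exact integral_nonneg fun t => sq_nonneg _

theorem isUnit_det_Mlam : IsUnit D.Mlam.det :=
  isUnit_det_of_sqNorm fun _ h => D.eq_zero_of_sqNorm_Mlam h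

/-- The coefficients, extended by zero to the interior nodes, of the `L²(Γ)`-projection of a
function in `Q_h`. -/
noncomputable def lift (p : Fin D.Np → ℝ) : Fin D.NI ⊕ Fin D.NB → ℝ :=
  D.extend (D.Mlam⁻¹ *ᵥ (D.Bp *ᵥ p))

theorem lift_sub (p q : Fin D.Np → ℝ) : D.lift (p - q) = D.lift p - D.lift q := by
  ext (i | i) <;> simp [lift, extend, mulVec_sub]

theorem Mlam_mulVec_lift (p : Fin D.Np → ℝ) :
    D.Mlam *ᵥ (D.Mlam⁻¹ *ᵥ (D.Bp *ᵥ p)) = D.Bp *ᵥ p := by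
  rw [mulVec_mulVec, mul_nonsing_inv _ D.isUnit_det_Mlam, one_mulVec]

theorem eq_of_Mlam_mulVec {w : Fin D.NB → ℝ} {b : Fin D.NB → ℝ} (h : D.Mlam *ᵥ w = b) :
    w = D.Mlam⁻¹ *ᵥ b := by
  rw [← h, mulVec_mulVec, nonsing_inv_mul _ D.isUnit_det_Mlam, one_mulVec]

variable {D} {τ : ℝ} {fu : ℤ → Fin D.NI ⊕ Fin D.NB → ℝ} {fp : ℤ → Fin D.Np → ℝ}
  {u : ℤ → Fin D.NI ⊕ Fin D.NB → ℝ} {p : ℤ → Fin D.Np → ℝ} {lam : ℤ → Fin D.NB → ℝ}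

/-- Consistency of the initial data extends the trace equation down to `-1`, the oldest value of `u`
that the BDF-2 quotient uses in the first step. -/
theorem IsSolution.trace_eq (hk : 1 ≤ k) (hS : D.IsSolution τ fu fp u p lam) {j : ℤ}
    (hj : -1 ≤ j) : u j ∘ Sum.inr = D.Mlam⁻¹ *ᵥ (D.Bp *ᵥ p j) := by
  refine D.eq_of_Mlam_mulVec ?_
  rcases (by omega : j = -1 ∨ j = 0 ∨ 1 ≤ j) with rfl | rfl | h
  · rw [← D.Bu_mulVec hk, hS.consistent_neg_one]
  · rw [← D.Bu_mulVec hk, hS.consistent_zero]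
  · exact hS.eq_trace j h

/-- The scheme, tested with the increments of the solution. -/
theorem IsSolution.tested (hk : 1 ≤ k) (hS : D.IsSolution τ fu fp u p lam) {m : ℤ} (hm : 1 ≤ m) :
    bdiff u m ⬝ᵥ (D.Mu *ᵥ bdf2 τ u m) + bdiff u m ⬝ᵥ (D.Ku *ᵥ u m)
      + bdiff p m ⬝ᵥ (D.Mp *ᵥ bdf2 τ p m) + bdiff p m ⬝ᵥ (D.Kp *ᵥ p m) =
    bdiff u m ⬝ᵥ fu m + bdiff p m ⬝ᵥ fp m
      + 3 / (2 * τ) * (bdiff u m ⬝ᵥ (D.Mu *ᵥ D.lift (bdiff (bdiff (bdiff p)) m)))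
      + bdiff u m ⬝ᵥ (D.Ku *ᵥ D.lift (bdiff (bdiff p) m)) := by
  have h0 := hS.trace_eq hk (show -1 ≤ m by omega)
  have h1 := hS.trace_eq hk (show -1 ≤ m - 1 by omega)
  have h2 := hS.trace_eq hk (show -1 ≤ m - 2 by omega)
  set L : (Fin D.Np → ℝ) → Fin D.NB → ℝ := fun q => D.Mlam⁻¹ *ᵥ (D.Bp *ᵥ q) with hL
  have hE : bdiff u m ∘ Sum.inr = L (bdiff p m) := by
    have : bdiff u m ∘ Sum.inr = u m ∘ Sum.inr - u (m - 1) ∘ Sum.inr := rfl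
    rw [this, h0, h1, hL]
    simp only [bdiff, mulVec_sub]
  have hK1 : (u m - D.lift (bdiff (bdiff p) m)) ∘ Sum.inl = u m ∘ Sum.inl := by
    ext i; simp [lift, extend]
  -- The extrapolated trace is the current trace minus the lift of $E^2p^m$.
  have hK2 : (u m - D.lift (bdiff (bdiff p) m)) ∘ Sum.inr =
      L ((2 : ℝ) • p (m - 1) - p (m - 2)) := by
    have : (u m - D.lift (bdiff (bdiff p) m)) ∘ Sum.inr =
      u m ∘ Sum.inr - L (bdiff (bdiff p) m) := by ext i; simp [lift, extend, hL]
    rw [this, h0, hL]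
    simp only [bdiff, show m - 1 - 1 = m - 2 by ring, mulVec_sub, mulVec_smul]
    module
  have hM1 : (bdf2 τ u m - (3 / (2 * τ)) • D.lift (bdiff (bdiff (bdiff p)) m)) ∘ Sum.inl =
      bdf2 τ (fun j => u j ∘ Sum.inl) m := by
    ext i; simp [lift, extend, bdf2]; ring
  -- Likewise the delayed quotient differs from the BDF-2 quotient by $\frac3{2\tau}E^3p^m$; the
  -- oldest term $p^{m-3}$ enters only through this third difference.
  have hM2 : (bdf2 τ u m - (3 / (2 * τ)) • D.lift (bdiff (bdiff (bdiff p)) m)) ∘ Sum.inr =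
      L (delayQuotient τ p m) := by
    have : (bdf2 τ u m - (3 / (2 * τ)) • D.lift (bdiff (bdiff (bdiff p)) m)) ∘ Sum.inr =
      (1 / (2 * τ)) • ((3 : ℝ) • (u m ∘ Sum.inr) - (4 : ℝ) • (u (m - 1) ∘ Sum.inr)
        + u (m - 2) ∘ Sum.inr) - (3 / (2 * τ)) • L (bdiff (bdiff (bdiff p)) m) := by
      ext i; simp [lift, extend, hL, bdf2]
    rw [this, h0, h1, h2, hL]
    simp only [bdiff, delayQuotient, show m - 1 - 1 = m - 2 by ring,
      show m - 2 - 1 = m - 3 by ring, mulVec_sub, mulVec_add, mulVec_smul]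
    module
  have e1 := congrArg (fun y => (bdiff u m ∘ Sum.inl) ⬝ᵥ y) (hS.eq_interior m hm)
  have e2 := congrArg (fun y => (bdiff u m ∘ Sum.inr) ⬝ᵥ y) (hS.eq_multiplier m hm)
  have e3 := congrArg (fun y => bdiff p m ⬝ᵥ y) (hS.eq_surface m hm)
  have b1 := dotProduct_mulVec_toBlocks D.Mu (bdiff u m)
    (bdf2 τ u m - (3 / (2 * τ)) • D.lift (bdiff (bdiff (bdiff p)) m))
  have b2 := dotProduct_mulVec_toBlocks D.Ku (bdiff u m) (u m - D.lift (bdiff (bdiff p) m))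
  rw [hM1, hM2] at b1
  rw [hK1, hK2] at b2
  have b3 : bdiff u m ⬝ᵥ fu m =
      (bdiff u m ∘ Sum.inl) ⬝ᵥ (fu m ∘ Sum.inl) + (bdiff u m ∘ Sum.inr) ⬝ᵥ (fu m ∘ Sum.inr) := by
    simp [dotProduct, Fintype.sum_sum_type]
  -- The increments inherit the trace matching, so the multiplier terms of the bulk and surface
  -- equations cancel.
  have b4 : bdiff p m ⬝ᵥ (D.Bpᵀ *ᵥ lam m) = (bdiff u m ∘ Sum.inr) ⬝ᵥ (D.Mlam *ᵥ lam m) := by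
    rw [hE, D.isSymm_Mlam.dotProduct_mulVec_comm, hL]
    simp only
    rw [D.Mlam_mulVec_lift, mulVec_transpose, dotProduct_comm, dotProduct_mulVec]
  simp only [dotProduct_add, dotProduct_sub, mulVec_sub, mulVec_smul, dotProduct_smul,
    smul_eq_mul, hL] at e1 e2 e3 b1 b2
  linarith

end Energy

end BulkSurfaceFE

/-! ### The one-step energy inequality and its summation -/

namespace BulkSurfaceFE

section Energy

variable {n k : ℕ} {D : BulkSurfaceFE (n + 1) k} {τ : ℝ} {fu : ℤ → Fin D.NI ⊕ Fin D.NB → ℝ}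
  {fp : ℤ → Fin D.Np → ℝ} {u : ℤ → Fin D.NI ⊕ Fin D.NB → ℝ} {p : ℤ → Fin D.Np → ℝ}
  {lam : ℤ → Fin D.NB → ℝ}

/-- The functional that is controlled from step to step, with `a = 9 c_M h`. -/
noncomputable def stepEnergy (D : BulkSurfaceFE (n + 1) k) (a τ : ℝ)
    (u : ℤ → Fin D.NI ⊕ Fin D.NB → ℝ) (p : ℤ → Fin D.Np → ℝ) (m : ℤ) : ℝ :=
  sqNorm D.Ku (u m) + sqNorm D.Kp (p m)
    + 1 / (2 * τ) * (sqNorm D.Mu (bdiff u m) + sqNorm D.Mp (bdiff p m))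
    + a / τ * sqNorm D.Mp (bdiff (bdiff p) m)

/-- The dissipation in one step, with `a = 9 c_M h` and `b = c_K / h`. -/
noncomputable def stepDissipation (D : BulkSurfaceFE (n + 1) k) (a b τ : ℝ)
    (u : ℤ → Fin D.NI ⊕ Fin D.NB → ℝ) (p : ℤ → Fin D.Np → ℝ) (m : ℤ) : ℝ :=
  1 / τ * (sqNorm D.Mu (bdiff u m) + sqNorm D.Mp (bdiff p m)
    + 1 / 2 * sqNorm D.Mu (bdiff (bdiff u) m)) + sqNorm D.Kp (bdiff p m)
    + (1 / (2 * τ) - 2 * a / τ - b) * sqNorm D.Mp (bdiff (bdiff p) m)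

/-- Of the `2 / τ` in front of the bulk increment, `1 / (2 * τ)` pays for `fu` and the same amount
for the mass perturbation; `1 / τ` is left. The second difference of `p` loses `2 * a / τ`: once
through Young's inequality, and once because the same term is carried in `stepEnergy` to pay for the
older second difference in the next step. -/
theorem IsSolution.step (hk : 1 ≤ k) (hτ : 0 < τ) {a b : ℝ}
    (ha : ∀ q, 9 * sqNorm D.Mu (D.lift q) ≤ a * sqNorm D.Mp q)
    (hb : ∀ q, sqNorm D.Ku (D.lift q) ≤ b * sqNorm D.Mp q)
    (hS : D.IsSolution τ fu fp u p lam) {m : ℤ} (hm : 1 ≤ m) :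
    D.stepEnergy a τ u p m + D.stepDissipation a b τ u p m ≤
      D.stepEnergy a τ u p (m - 1) + 2 * τ * (sqNorm D.Mu⁻¹ (fu m) + sqNorm D.Mp⁻¹ (fp m)) := by
  have e := hS.tested hk hm
  have t1 := dotProduct_bdf2 D.isSymm_Mu τ u m
  have t2 := dotProduct_bdf2 D.isSymm_Mp τ p m
  have t3 := two_mul_dotProduct_bdiff D.isSymm_Ku u m
  have t4 := two_mul_dotProduct_bdiff D.isSymm_Kp p m
  have f1 := two_mul_dotProduct_le D.isSymm_Mu D.sqNorm_Mu_nonneg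
    (isUnit_det_of_sqNorm fun _ h => D.eq_zero_of_sqNorm_Mu hk h) hτ (bdiff u m) (fu m)
  have f2 := two_mul_dotProduct_le D.isSymm_Mp D.sqNorm_Mp_nonneg
    (isUnit_det_of_sqNorm fun _ h => D.eq_zero_of_sqNorm_Mp h) hτ (bdiff p m) (fp m)
  -- Young's inequality gives `9` times the mass of the lifted third difference, and splitting it
  -- into two second differences gives a factor `2`; this is the origin of `a = 9 c_M h`.
  have g1 : 2 * (3 / (2 * τ) * (bdiff u m ⬝ᵥ (D.Mu *ᵥ D.lift (bdiff (bdiff (bdiff p)) m)))) ≤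
      1 / (2 * τ) * sqNorm D.Mu (bdiff u m) + a / τ * sqNorm D.Mp (bdiff (bdiff p) m)
        + a / τ * sqNorm D.Mp (bdiff (bdiff p) (m - 1)) := by
    have h1 := D.sqNorm_Mu_nonneg (bdiff u m - (3 : ℝ) • D.lift (bdiff (bdiff (bdiff p)) m))
    rw [sqNorm_sub D.isSymm_Mu, sqNorm_smul, mulVec_smul, dotProduct_smul, smul_eq_mul] at h1
    have h2 : bdiff (bdiff (bdiff p)) m = bdiff (bdiff p) m - bdiff (bdiff p) (m - 1) := rfl
    have h3 := sqNorm_sub D.isSymm_Mu (D.lift (bdiff (bdiff p) m))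
      (D.lift (bdiff (bdiff p) (m - 1)))
    have h4 := D.sqNorm_Mu_nonneg
      (D.lift (bdiff (bdiff p) m) - (-1 : ℝ) • D.lift (bdiff (bdiff p) (m - 1)))
    rw [sqNorm_sub D.isSymm_Mu, sqNorm_smul, mulVec_smul, dotProduct_smul, smul_eq_mul] at h4
    rw [← lift_sub, ← h2] at h3
    have h5 := ha (bdiff (bdiff p) m)
    have h6 := ha (bdiff (bdiff p) (m - 1))
    have h7 : 6 * (bdiff u m ⬝ᵥ (D.Mu *ᵥ D.lift (bdiff (bdiff (bdiff p)) m))) ≤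
        sqNorm D.Mu (bdiff u m) + 2 * (a * sqNorm D.Mp (bdiff (bdiff p) m))
          + 2 * (a * sqNorm D.Mp (bdiff (bdiff p) (m - 1))) := by linarith
    calc 2 * (3 / (2 * τ) * (bdiff u m ⬝ᵥ (D.Mu *ᵥ D.lift (bdiff (bdiff (bdiff p)) m))))
        = 1 / (2 * τ) * (6 * (bdiff u m ⬝ᵥ (D.Mu *ᵥ D.lift (bdiff (bdiff (bdiff p)) m)))) := by
          ring
      _ ≤ 1 / (2 * τ) * (sqNorm D.Mu (bdiff u m) + 2 * (a * sqNorm D.Mp (bdiff (bdiff p) m))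
          + 2 * (a * sqNorm D.Mp (bdiff (bdiff p) (m - 1)))) := by gcongr
      _ = _ := by field_simp
  -- The stiffness norm of the increment, gained from the implicit term, is used up completely here.
  have g2 : 2 * (bdiff u m ⬝ᵥ (D.Ku *ᵥ D.lift (bdiff (bdiff p) m))) ≤
      sqNorm D.Ku (bdiff u m) + b * sqNorm D.Mp (bdiff (bdiff p) m) := by
    have h1 := D.sqNorm_Ku_nonneg (bdiff u m - D.lift (bdiff (bdiff p) m))
    rw [sqNorm_sub D.isSymm_Ku] at h1
    linarith [hb (bdiff (bdiff p) m)]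
  -- The surface increment pays only for `fp`, so this surplus is dropped.
  have hp0 : 0 ≤ 1 / (2 * τ) * sqNorm D.Mp (bdiff p m) := by
    have := D.sqNorm_Mp_nonneg (bdiff p m)
    positivity
  have r1 : 2 / τ = 4 * (1 / (2 * τ)) := by field_simp; norm_num
  have r2 : 1 / τ = 2 * (1 / (2 * τ)) := by field_simp
  have r3 : 2 * a / τ = 2 * (a / τ) := by ring
  rw [r1] at t1 t2
  unfold stepEnergy stepDissipation
  rw [r2, r3]
  linarith

theorem IsSolution.sum_step (hk : 1 ≤ k) (hτ : 0 < τ) {a b : ℝ}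
    (ha : ∀ q, 9 * sqNorm D.Mu (D.lift q) ≤ a * sqNorm D.Mp q)
    (hb : ∀ q, sqNorm D.Ku (D.lift q) ≤ b * sqNorm D.Mp q)
    (hS : D.IsSolution τ fu fp u p lam) {m : ℤ} (hm : 0 ≤ m) :
    D.stepEnergy a τ u p m + ∑ j ∈ Finset.Icc 1 m, D.stepDissipation a b τ u p j ≤
      D.stepEnergy a τ u p 0
        + 2 * τ * ∑ j ∈ Finset.Icc 1 m, (sqNorm D.Mu⁻¹ (fu j) + sqNorm D.Mp⁻¹ (fp j)) := by
  induction m, hm using Int.leInduction with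
  | base => simp
  | succ m hm ih =>
    have h1 : Finset.Icc 1 (m + 1) = insert (m + 1) (Finset.Icc 1 m) := by
      ext j
      simp only [Finset.mem_Icc, Finset.mem_insert]
      omega
    have h2 : m + 1 ∉ Finset.Icc 1 m := by simp
    have h3 := hS.step hk hτ ha hb (show 1 ≤ m + 1 by omega)
    rw [add_sub_cancel_right] at h3
    rw [h1, Finset.sum_insert h2, Finset.sum_insert h2]
    linarith

/-- The stability estimate in terms of the constants of the trace and inverse inequalities. -/
theorem IsSolution.energy_le (hk : 1 ≤ k) (hτ : 0 < τ) {cM cK : ℝ} (hcM : 0 ≤ cM)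
    (hM : ∀ q, sqNorm D.Mu (D.lift q) ≤ cM * D.h * sqNorm D.Mp q)
    (hK : ∀ q, sqNorm D.Ku (D.lift q) ≤ cK * D.h⁻¹ * sqNorm D.Mp q)
    (hS : D.IsSolution τ fu fp u p lam) {m : ℤ} (hm : 0 ≤ m) :
    D.energy τ u p m + τ * ∑ j ∈ Finset.Icc 1 m, (1 / 2 - 18 * cM * D.h - cK * τ * D.h⁻¹)
        * sqNorm D.Mp (τ⁻¹ • bdiff (bdiff p) j) ≤ D.dataBound cM τ fu fp u p m := by
  have h1 := hS.sum_step hk hτ (a := 9 * cM * D.h) (b := cK * D.h⁻¹)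
    (fun q => by linarith [hM q]) hK hm
  have h2 : ∑ j ∈ Finset.Icc 1 m, D.stepDissipation (9 * cM * D.h) (cK * D.h⁻¹) τ u p j =
      τ * ∑ j ∈ Finset.Icc 1 m,
        (sqNorm D.Mu (τ⁻¹ • bdiff u j) + sqNorm D.Mp (τ⁻¹ • bdiff p j)
          + 1 / 2 * sqNorm D.Mu (τ⁻¹ • bdiff (bdiff u) j))
      + ∑ j ∈ Finset.Icc 1 m, sqNorm D.Kp (bdiff p j)
      + τ * ∑ j ∈ Finset.Icc 1 m, (1 / 2 - 18 * cM * D.h - cK * τ * D.h⁻¹)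
        * sqNorm D.Mp (τ⁻¹ • bdiff (bdiff p) j) := by
    rw [Finset.mul_sum, Finset.mul_sum, ← Finset.sum_add_distrib, ← Finset.sum_add_distrib]
    refine Finset.sum_congr rfl fun j _ => ?_
    simp only [sqNorm_smul, stepDissipation]
    -- The inverse mesh width is treated as an arbitrary number, so `D.h ≠ 0` is not needed.
    generalize D.h⁻¹ = g
    field_simp
    ring
  -- These parts of `stepEnergy` at the final time do not occur in `energy` and are discarded.
  have h3 : 0 ≤ 1 / (2 * τ) * (sqNorm D.Mu (bdiff u m) + sqNorm D.Mp (bdiff p m))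
      + 9 * cM * D.h / τ * sqNorm D.Mp (bdiff (bdiff p) m) := by
    have := D.h_nonneg
    have := D.sqNorm_Mu_nonneg (bdiff u m)
    have := D.sqNorm_Mp_nonneg (bdiff p m)
    have := D.sqNorm_Mp_nonneg (bdiff (bdiff p) m)
    positivity
  have h4 : D.stepEnergy (9 * cM * D.h) τ u p 0 =
      sqNorm D.Ku (u 0) + sqNorm D.Kp (p 0)
        + τ / 2 * sqNorm D.Mu (τ⁻¹ • bdiff u 0) + τ / 2 * sqNorm D.Mp (τ⁻¹ • bdiff p 0)
        + 9 * cM * τ * D.h * sqNorm D.Mp (τ⁻¹ • bdiff (bdiff p) 0) := by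
    simp only [sqNorm_smul, stepEnergy]
    field_simp
    ring
  rw [h2, h4] at h1
  unfold stepEnergy at h1
  unfold energy dataBound
  linarith

end Energy

/-! ### From trace norms to the constants of the theorem -/

theorem lift_bounds {n k : ℕ} {D : BulkSurfaceFE (n + 1) k} (hk : 1 ≤ k) {cM cK : ℝ}
    (hcM : 0 ≤ cM) (hcK : 0 ≤ cK)
    (hM : ∀ w, sqNorm D.Mu (D.extend w) ≤ cM * D.h * sqNorm D.Mlam w)
    (hK : ∀ w, sqNorm D.Ku (D.extend w) ≤ cK * D.h⁻¹ * sqNorm D.Mlam w) :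
    (∀ (u : Fin D.NI ⊕ Fin D.NB → ℝ) (p : Fin D.Np → ℝ), D.Bu *ᵥ u = D.Bp *ᵥ p →
      sqNorm D.Mu.toBlocks₂₂ (u ∘ Sum.inr) ≤ cM * D.h * sqNorm D.Mp p ∧
      sqNorm D.Ku.toBlocks₂₂ (u ∘ Sum.inr) ≤ cK * D.h⁻¹ * sqNorm D.Mp p) ∧
    (∀ q, sqNorm D.Mu (D.lift q) ≤ cM * D.h * sqNorm D.Mp q) ∧
    ∀ q, sqNorm D.Ku (D.lift q) ≤ cK * D.h⁻¹ * sqNorm D.Mp q := by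
  have hh := D.h_nonneg
  have hh' := inv_nonneg.2 hh
  have h1 : ∀ w q, D.Mlam *ᵥ w = D.Bp *ᵥ q →
      sqNorm D.Mu (D.extend w) ≤ cM * D.h * sqNorm D.Mp q ∧
      sqNorm D.Ku (D.extend w) ≤ cK * D.h⁻¹ * sqNorm D.Mp q := fun w q h => by
    have h2 := D.sqNorm_Mlam_le h
    exact ⟨(hM w).trans (by gcongr), (hK w).trans (by gcongr)⟩
  refine ⟨fun u p h => ?_, fun q => (h1 _ q (D.Mlam_mulVec_lift q)).1,
    fun q => (h1 _ q (D.Mlam_mulVec_lift q)).2⟩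
  rw [D.Bu_mulVec hk] at h
  rw [sqNorm_toBlocks₂₂, sqNorm_toBlocks₂₂]
  exact h1 _ p h

end BulkSurfaceFE

theorem mainTheorem4 (d k : ℕ) (hd : d = 2 ∨ d = 3) (hk : 1 ≤ k) (σ : ℝ) (hσ : 0 < σ) :
    ∃ cM > 0, ∀ αmax > 0, ∃ cK > 0, ∃ h₀ > 0, ∃ C > 0,
      ∀ D : BulkSurfaceFE d k, D.QuasiUniform σ →
        (∀ᵐ x ∂(volume.restrict D.Ω), D.α x ≤ αmax) →
        (∀ (u : Fin D.NI ⊕ Fin D.NB → ℝ) (p : Fin D.Np → ℝ), D.Bu *ᵥ u = D.Bp *ᵥ p →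
          sqNorm D.Mu.toBlocks₂₂ (u ∘ Sum.inr) ≤ cM * D.h * sqNorm D.Mp p ∧
          sqNorm D.Ku.toBlocks₂₂ (u ∘ Sum.inr) ≤ cK * D.h⁻¹ * sqNorm D.Mp p) ∧
        (∀ (τ : ℝ), 0 < τ →
          ∀ (fu : ℤ → Fin D.NI ⊕ Fin D.NB → ℝ) (fp : ℤ → Fin D.Np → ℝ)
            (u : ℤ → Fin D.NI ⊕ Fin D.NB → ℝ) (p : ℤ → Fin D.Np → ℝ) (lam : ℤ → Fin D.NB → ℝ),
          D.IsSolution τ fu fp u p lam →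
          ∀ n : ℤ, -2 ≤ n →
            D.energy τ u p (n + 3)
              + τ * ∑ j ∈ Finset.Icc 1 (n + 3),
                  (1 / 2 - 18 * cM * D.h - cK * τ * D.h⁻¹)
                    * sqNorm D.Mp (τ⁻¹ • bdiff (bdiff p) j)
              ≤ D.dataBound cM τ fu fp u p (n + 3) ∧
            (D.h ≤ h₀ → τ ≤ C * D.h →
              0 ≤ 1 / 2 - 18 * cM * D.h - cK * τ * D.h⁻¹ ∧
              D.energy τ u p (n + 3) ≤ D.dataBound cM τ fu fp u p (n + 3))) := by
  obtain ⟨N, rfl⟩ : ∃ N, d = N + 1 := ⟨d - 1, by omega⟩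
  obtain ⟨cM, hcM, HM⟩ := BulkSurfaceFE.exists_mass_bound N k hk hσ
  refine ⟨cM, hcM, fun αmax hα => ?_⟩
  obtain ⟨cK, hcK, HK⟩ := BulkSurfaceFE.exists_stiffness_bound N k hk hσ hα
  -- Each of the two subtracted terms gets half of the available `1 / 2`. The constant `cM` was
  -- fixed before `αmax` and hence does not depend on it.
  refine ⟨cK, hcK, 1 / (72 * cM), by positivity, 1 / (4 * cK), by positivity,
    fun D hD hDα => ?_⟩
  obtain ⟨h1, h2, h3⟩ := BulkSurfaceFE.lift_bounds hk hcM.le hcK.le (HM D hD) (HK D hD hDα)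
  refine ⟨h1, fun τ hτ fu fp u p lam hS n hn => ?_⟩
  have h4 := hS.energy_le hk hτ hcM.le h2 h3 (show 0 ≤ n + 3 by omega)
  refine ⟨h4, fun hh₀ hτC => ?_⟩
  -- The step size condition with `0 < τ` excludes a vanishing mesh width.
  have hh : 0 < D.h := by
    by_contra! hle
    have := mul_nonpos_of_nonneg_of_nonpos (by positivity : 0 ≤ 1 / (4 * cK)) hle
    linarith
  have h5 : 18 * cM * D.h ≤ 1 / 4 := by
    calc 18 * cM * D.h ≤ 18 * cM * (1 / (72 * cM)) := by gcongr
      _ = 1 / 4 := by field_simp; norm_num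
  have h6 : cK * τ * D.h⁻¹ ≤ 1 / 4 := by
    calc cK * τ * D.h⁻¹ ≤ cK * (1 / (4 * cK) * D.h) * D.h⁻¹ := by gcongr
      _ = 1 / 4 := by field_simp
  have h7 : 0 ≤ 1 / 2 - 18 * cM * D.h - cK * τ * D.h⁻¹ := by linarith
  refine ⟨h7, le_trans (le_add_of_nonneg_right ?_) h4⟩
  exact mul_nonneg hτ.le (Finset.sum_nonneg fun j _ => mul_nonneg h7 (D.sqNorm_Mp_nonneg _))
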